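/- All compact spaces below are Hausdorff. A space $X$ is \emph{weakly infinite dimensional} if for every sequence $(A_i,B_i)_{i\in\mathbb N}$ of pairs of disjoint closed subsets of $X$ there are partitions $S_i$ between $A_i$ and $B_i$ (that is, $X\setminus S_i=U_i\cup V_i$ with $U_i,V_i$ disjoint open, $A_i\subseteq U_i$, $B_i\subseteq V_i$) such that $\bigcap_i S_i=\emptyset$; otherwise $X$ is \emph{strongly infinite dimensional}. $X$ has \emph{property $C$} if for every sequence $(\mathcal U_i)_{i\in\mathbb N}$ of open covers of $X$ there are families $\mathcal V_i$ of pairwise disjoint open subsets of $X$ such that each $\mathcal V_i$ refines $\mathcal U_i$ and $\bigcup_i\mathcal V_i$ covers $X$. For a compact space $X$ let $2^X$ be the lattice of closed subsets of $X$ (with $\cup,\cap,\emptyset,X$). For a lattice $L$ with least and greatest element let $wL$ be its Wallman space: the set of all ultrafilters (maximal proper filters) on $L$, with the sets $\hat a=\{u\in wL: a\in u\}$, $a\in L$, as a base for the closed sets. For an infinite cardinal $\kappa$ let $H(\kappa)$ be the set of all sets whose transitive closure has fewer than $\kappa$ elements. A property $\mathcal P$ of compact spaces is \emph{elementarily reflected}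 if, whenever a compact space $X$ has $\mathcal P$, then $wL$ has $\mathcal P$ for every elementary sublattice $L$ of $2^X$ (elementary substructure in the language of bounded lattices). It is \emph{elementarily reflected by submodels} if, whenever a compact space $X$ has $\mathcal P$, then $wL$ has $\mathcal P$ for every $L$ of the form $L=2^X\cap\mathcal M$, where $2^X\in\mathcal M$, $\mathcal M\prec H(\kappa)$ and $\kappa$ is a regular cardinal so large that $\mathcal P(\mathcal P(X))\in H(\kappa)$, where $\mathcal P(\mathcal P(X))$ denotes the power set of the power set of $X$. Then: (i) being strongly infinite dimensional is elementarily reflected by submodels; (ii) being weakly infinite dimensional is elementarily reflected by submodels; (iii) being weakly infinite dimensional is elementarily reflected; (iv) there is a compact metrizable space that is weakly infinite dimensional but does not have property $C$ if and only if there is a compact non-metrizable Hausdorff space that is weakly infinite dimensional but does not have property $C$. -/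

import Mathlib

open TopologicalSpace

/-! ### Property C and weak / strong infinite dimension -/

/-- `S` is a partition (separator) between `A` and `B`: its complement is the union of two disjoint
open sets, one containing `A` and the other containing `B`. -/
def IsPartitionBetween {X : Type*} [TopologicalSpace X] (S A B : Set X) : Prop :=
  ∃ U V : Set X, IsOpen U ∧ IsOpen V ∧ A ⊆ U ∧ B ⊆ V ∧ Disjoint U V ∧ Sᶜ = U ∪ V

/-- Weak infinite dimension: for every sequence of pairs of disjoint closed sets there are
partitions between the members of the pairs having empty intersection.
(Finite dimensional spaces are included.) -/
def WeaklyInfiniteDimensional (X : Type*) [TopologicalSpace X] : Prop :=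
  ∀ A B : ℕ → Set X, (∀ i, IsClosed (A i)) → (∀ i, IsClosed (B i)) →
    (∀ i, Disjoint (A i) (B i)) →
    ∃ S : ℕ → Set X, (∀ i, IsPartitionBetween (S i) (A i) (B i)) ∧ ⋂ i, S i = ∅

/-- A space is strongly infinite dimensional if it is not weakly infinite dimensional. -/
def StronglyInfiniteDimensional (X : Type*) [TopologicalSpace X] : Prop :=
  ¬ WeaklyInfiniteDimensional X

/-- `X` is a `C`-space: for each sequence of open covers `𝒰 i` there are families `𝒱 i` of pairwise
disjoint open sets such that `𝒱 i` refines `𝒰 i` and all the `𝒱 i` together cover `X`. -/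
def PropertyC (X : Type*) [TopologicalSpace X] : Prop :=
  ∀ 𝒰 : ℕ → Set (Set X), (∀ i, ∀ U ∈ 𝒰 i, IsOpen U) → (∀ i, ⋃₀ 𝒰 i = Set.univ) →
    ∃ 𝒱 : ℕ → Set (Set X),
      (∀ i, ∀ V ∈ 𝒱 i, IsOpen V) ∧
      (∀ i, (𝒱 i).Pairwise Disjoint) ∧
      (∀ i, ∀ V ∈ 𝒱 i, ∃ U ∈ 𝒰 i, V ⊆ U) ∧
      ⋃ i, ⋃₀ 𝒱 i = Set.univ

/-! ### Wallman spaces -/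

/-- The Wallman space of a lattice `L`: the set of all ultrafilters on `L`, i.e. of the maximal
proper filters. Only the order of `L` enters; for a lattice, `Order.PFilter` is the usual notion
of a (nonempty, upward closed, meet-closed) filter. -/
def WallmanSpace (L : Type*) [PartialOrder L] : Type _ :=
  {u : Order.PFilter L // Maximal (fun F : Order.PFilter L => (F : Set L) ≠ Set.univ) u}

/-- The set `â` of all ultrafilters on `L` containing `a`. -/
def WallmanSpace.hat {L : Type*} [PartialOrder L] (a : L) : Set (WallmanSpace L) :=
  {u | a ∈ u.1}

/-- The topology of the Wallman space: the sets `â` form a base for the closed sets. -/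
instance {L : Type*} [PartialOrder L] : TopologicalSpace (WallmanSpace L) :=
  generateFrom {U | ∃ a : L, U = (WallmanSpace.hat a)ᶜ}

/-! ### Elementary sublattices of `2^X` -/

/-- The operation symbols of bounded lattices. -/
inductive LatticeFunc : ℕ → Type
  | bot : LatticeFunc 0
  | top : LatticeFunc 0
  | sup : LatticeFunc 2
  | inf : LatticeFunc 2

/-- The first-order language of bounded lattices. -/
def latticeLanguage : FirstOrder.Language.{0, 0} where
  Functions := LatticeFunc
  Relations := fun _ => Empty

/-- Every bounded lattice is a structure for the language of bounded lattices. -/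
instance {L : Type*} [Lattice L] [BoundedOrder L] : latticeLanguage.Structure L where
  funMap f v := match f with
    | .bot => ⊥
    | .top => ⊤
    | .sup => v 0 ⊔ v 1
    | .inf => v 0 ⊓ v 1
  RelMap r _ := r.elim

universe u

/-- `P` is elementarily reflected: if a compact Hausdorff space `X` has `P`, then so has the Wallman
space of every elementary sublattice `L` of the lattice `2^X` of closed subsets of `X`
(operations `∪`, `∩`; bottom `∅`; top `X`). -/
def ElementarilyReflected (P : ∀ (Y : Type u) [TopologicalSpace Y], Prop) : Prop :=
  ∀ (X : Type u) [TopologicalSpace X] [CompactSpace X] [T2Space X], P X →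
    ∀ L : latticeLanguage.ElementarySubstructure (Closeds X), P (WallmanSpace L)

/-! ### Elementary submodels of `H(κ)` -/

/-- The relation symbol of set theory. -/
inductive MembershipRel : ℕ → Type
  | mem : MembershipRel 2

/-- The first-order language of set theory: one binary relation symbol. -/
def setLanguage : FirstOrder.Language.{0, 0} where
  Functions := fun _ => Empty
  Relations := MembershipRel

/-- Every class of sets is a structure for the language of set theory, with the true membership
relation. -/
instance (N : Set ZFSet.{u}) : setLanguage.Structure N where
  funMap f _ := f.elim
  RelMap r v := match r with
    | .mem => (v 0 : ZFSet.{u}) ∈ (v 1 : ZFSet.{u})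

/-- `M ≺ N`: `M` is an elementary submodel of `(N, ∈)`. -/
def IsElementarySubmodel (M N : Set ZFSet.{u}) : Prop :=
  ∃ S : setLanguage.ElementarySubstructure N, M = Subtype.val '' (S : Set N)

/-- The members of the transitive closure `x ∪ ⋃ x ∪ ⋃ ⋃ x ∪ …` of `x`. -/
def transitiveClosure (x : ZFSet.{u}) : Set ZFSet.{u} :=
  {y | Relation.TransGen (fun a b : ZFSet.{u} => a ∈ b) y x}

/-- `H(κ)`: all sets whose transitive closure has fewer than `κ` elements. -/
def hereditarySets (κ : Cardinal.{u}) : Set ZFSet.{u} :=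
  {x | Cardinal.mk (transitiveClosure x) < Cardinal.lift.{u + 1} κ}

/-- The set `2^X` of closed subsets of a topological space whose underlying set is the
ZFC set `X`. -/
noncomputable def closedSubsets (X : ZFSet.{u}) [TopologicalSpace X] : ZFSet.{u} :=
  ZFSet.sep (fun F => IsClosed {x : X | (x : ZFSet.{u}) ∈ F}) X.powerset

/-- `P` is elementarily reflected by submodels: if a compact Hausdorff space `X` has `P`, then so
has the Wallman space of the lattice `L = 2^X ∩ M` (ordered by inclusion) whenever `2^X ∈ M` and
`M ≺ H(κ)` with `κ` regular and so large that the power set of the power set of `X` is in `H(κ)`.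
A space is a ZFC set with a topology on its elements, so that the submodel can contain `2^X`. -/
def ElementarilyReflectedBySubmodels
    (P : ∀ (Y : Type (u + 1)) [TopologicalSpace Y], Prop) : Prop :=
  ∀ (X : ZFSet.{u}) [TopologicalSpace X] [CompactSpace X] [T2Space X], P X →
    ∀ (κ : Cardinal.{u}) (M : Set ZFSet.{u}),
      κ.IsRegular → X.powerset.powerset ∈ hereditarySets κ →
      IsElementarySubmodel M (hereditarySets κ) → closedSubsets X ∈ M →
      P (WallmanSpace {F : ZFSet.{u} // F ∈ closedSubsets X ∧ F ∈ M})

/-!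
The weak infinite dimension of a compact Hausdorff space is a statement about finitely many closed
sets at a time. By compactness, partitions `S i` between `A i` and `B i` with `⋂ i, S i = ∅` exist
if and only if, for some `n`, the lattice of closed sets contains `c i`, `d i` (`i < n`) with
`c i ⊔ d i = ⊤`, `c i ⊓ A i = ⊥`, `d i ⊓ B i = ⊥` and `⨅ i < n, c i ⊓ d i = ⊥`; the partitions are
`c i ⊓ d i`. This is `HasEmptyPartition`, and it can be tested on every lattice base for the closed
sets (`IsClosedBase.weaklyInfiniteDimensional_iff`), in particular on `L` as a base of the Wallman
space of `L`. Being normal and separative passes from `2^X` to an elementary sublattice, and it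
makes the Wallman space compact Hausdorff with base `L`.

For fixed `n` the existence of the `c i`, `d i` is first-order in the parameters `A i`, `B i`. Hence
it goes down from `2^X` to an elementary sublattice, which gives the elementary reflection of weak
infinite dimension. It is also first-order over `H(κ)` with the parameter `2^X`, which gives the
reflection by submodels.

For strong infinite dimension a sequence of pairs has to be found in the submodel `M`. Instead of
coding sequences as sets, the proof uses a set `T` of families of nonempty closed sets such that
each `K ∈ T` has a successor: a disjoint pair `a`, `b` and a `K' ∈ T` containing `y ∩ S` for all
`y ∈ K` and all partitions `S` between `a` and `b` (`IsEssentialTree`). A witnessing sequence in `X`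
gives such a `T` in `H(κ)`, one of whose members contains `X`. By elementarity `M` contains such a
`T`; starting from a member of `T` that contains `X`, elementarity yields successors in `M` one
after the other, and the resulting sequence of pairs in `2^X ∩ M` admits no partitions with empty
intersection, since all the intersections of its partitions are members of families in `T`.

For the equivalence at the end, a metrizable example becomes nonmetrizable by adding a large Cantor
cube as a clopen summand. Conversely, take a nonmetrizable example and a sequence of finite open
covers that violates property C. By the Löwenheim–Skolem theorem the complements of their members
lie in a countable elementary sublattice `L` of `2^X`. Its Wallman space is second countable, hence
metrizable, and weakly infinite dimensional by reflection. It does not have property C, because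
disjoint families of open sets in it have disjoint traces in `X` (`wallmanTrace`).
-/

/-! ### Partitions in bounded lattices -/

section Lattice

variable {L : Type*} [Lattice L] [BoundedOrder L]

/-- The pair `c`, `d` encodes, in a lattice of closed sets, the partition `c ⊓ d` between `a` and
`b`: the complements of `c` and `d` are disjoint open sets around `a` and `b`. -/
def IsPartitionPair (a b c d : L) : Prop :=
  c ⊔ d = ⊤ ∧ c ⊓ a = ⊥ ∧ d ⊓ b = ⊥

/-- There are partitions between `a i` and `b i`, for `i < n`, whose common part misses `y`. -/
def HasEmptyPartition : ℕ → (ℕ → L) → (ℕ → L) → L → Prop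
  | 0, _, _, y => y = ⊥
  | n + 1, a, b, y =>
    ∃ c d, IsPartitionPair (a n) (b n) c d ∧ HasEmptyPartition n a b (y ⊓ (c ⊓ d))

theorem hasEmptyPartition_iff {n : ℕ} {a b : ℕ → L} {y : L} :
    HasEmptyPartition n a b y ↔ ∃ c d : ℕ → L, (∀ i < n, IsPartitionPair (a i) (b i) (c i) (d i)) ∧
      y ⊓ (Finset.range n).inf (fun i => c i ⊓ d i) = ⊥ := by
  induction n generalizing y with
  | zero => simp [HasEmptyPartition]
  | succ n ih =>
    constructor
    · rintro ⟨c, d, hcd, h⟩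
      obtain ⟨c', d', h1, h2⟩ := ih.1 h
      refine ⟨fun i => if i < n then c' i else c, fun i => if i < n then d' i else d, ?_, ?_⟩
      · intro i hi
        by_cases hin : i < n
        · simpa [hin] using h1 i hin
        · obtain rfl : i = n := by omega
          simpa using hcd
      · rw [Finset.range_add_one, Finset.inf_insert, ← inf_assoc]
        simp only [lt_irrefl, if_false]
        rw [← h2]
        congr 1
        refine Finset.inf_congr rfl fun i hi => ?_
        simp [Finset.mem_range.1 hi]
    · rintro ⟨c, d, h1, h2⟩
      refine ⟨c n, d n, h1 n (Nat.lt_succ_self n), ih.2 ⟨c, d, fun i hi => h1 i (by omega), ?_⟩⟩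
      rwa [Finset.range_add_one, Finset.inf_insert, ← inf_assoc] at h2

variable (L) in
/-- Disjoint members of the lattice admit a partition. -/
def IsNormalLattice : Prop :=
  ∀ a b : L, a ⊓ b = ⊥ → ∃ c d, IsPartitionPair a b c d

variable (L) in
/-- The order is separative: if `a ≰ b`, some nonzero element below `a` is disjoint from `b`. -/
def IsSeparativeLattice : Prop :=
  ∀ a b : L, ¬ a ≤ b → ∃ c, c ≠ ⊥ ∧ c ≤ a ∧ c ⊓ b = ⊥

end Lattice

/-! ### Weak infinite dimension in terms of a lattice base for the closed sets -/

/-- The lattice homomorphism `h` represents `L` by closed subsets of `Y`, detecting the bottom and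
the top element, and finely enough to interpolate between closed sets and open sets around them. -/
structure IsClosedBase {L Y : Type*} [Lattice L] [BoundedOrder L] [TopologicalSpace Y]
    (h : L → Set Y) : Prop where
  isClosed : ∀ a, IsClosed (h a)
  map_inf : ∀ a b, h (a ⊓ b) = h a ∩ h b
  map_sup : ∀ a b, h (a ⊔ b) = h a ∪ h b
  map_bot : h ⊥ = ∅
  map_top : h ⊤ = Set.univ
  le_of_subset : ∀ a b, h a ⊆ h b → a ≤ b
  interpolate : ∀ A O : Set Y, IsClosed A → IsOpen O → A ⊆ O → ∃ a, A ⊆ h a ∧ h a ⊆ O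

theorem exists_isPartitionBetween {Y : Type*} [TopologicalSpace Y] [NormalSpace Y] {A B : Set Y}
    (hA : IsClosed A) (hB : IsClosed B) (h : Disjoint A B) : ∃ S, IsPartitionBetween S A B := by
  obtain ⟨U, V, hU, hV, hAU, hBV, hUV⟩ := normal_separation hA hB h
  exact ⟨(U ∪ V)ᶜ, U, V, hU, hV, hAU, hBV, hUV, compl_compl _⟩

namespace IsClosedBase

variable {L Y : Type*} [Lattice L] [BoundedOrder L] [TopologicalSpace Y] {h : L → Set Y}

theorem eq_empty_iff (H : IsClosedBase h) (a : L) : h a = ∅ ↔ a = ⊥ :=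
  ⟨fun ha => le_bot_iff.1 (H.le_of_subset _ _ (ha ▸ Set.empty_subset _)), fun ha => ha ▸ H.map_bot⟩

theorem eq_univ_iff (H : IsClosedBase h) (a : L) : h a = Set.univ ↔ a = ⊤ :=
  ⟨fun ha => top_le_iff.1 (H.le_of_subset _ _ (ha ▸ Set.subset_univ _)), fun ha => ha ▸ H.map_top⟩

theorem map_finset_inf (H : IsClosedBase h) (f : ℕ → L) (n : ℕ) :
    h ((Finset.range n).inf f) = ⋂ i < n, h (f i) := by
  induction n with
  | zero => simp [H.map_top]
  | succ n ih =>
    rw [Finset.range_add_one, Finset.inf_insert, H.map_inf, ih, Set.biInter_lt_succ, Set.inter_comm]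

theorem disjoint_iff (H : IsClosedBase h) {a b : L} : Disjoint (h a) (h b) ↔ a ⊓ b = ⊥ := by
  rw [Set.disjoint_iff_inter_eq_empty, ← H.map_inf, H.eq_empty_iff]

/-- Finitely many partitions in the space can be swollen to members of the base without creating
a point in their intersection. -/
theorem hasEmptyPartition (H : IsClosedBase h) {a b : ℕ → L} {C D : ℕ → Set Y}
    (hC : ∀ i, IsClosed (C i)) (hD : ∀ i, IsClosed (D i)) (hCD : ∀ i, C i ∪ D i = Set.univ)
    (hCa : ∀ i, Disjoint (C i) (h (a i))) (hDb : ∀ i, Disjoint (D i) (h (b i)))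
    (n : ℕ) (y : L) (hy : h y ∩ ⋂ i < n, C i ∩ D i = ∅) : HasEmptyPartition n a b y := by
  induction n generalizing y with
  | zero => simpa [H.eq_empty_iff, HasEmptyPartition] using hy
  | succ n ih =>
    set E : Set Y := h y ∩ ⋂ i < n, C i ∩ D i with hE
    have hEc : IsClosed E := (H.isClosed y).inter
      (isClosed_biInter fun i _ => (hC i).inter (hD i))
    have hECD : E ∩ (C n ∩ D n) = ∅ := by
      rw [← hy, Set.biInter_lt_succ, hE, Set.inter_assoc]
    obtain ⟨c, hCc, hc⟩ := H.interpolate (C n) ((E ∩ D n)ᶜ ∩ (h (a n))ᶜ) (hC n)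
      ((hEc.inter (hD n)).isOpen_compl.inter (H.isClosed _).isOpen_compl) (by
        intro x hx
        refine ⟨fun hx' => ?_, fun hx' => (hCa n).le_bot ⟨hx, hx'⟩⟩
        have : x ∈ E ∩ (C n ∩ D n) := ⟨hx'.1, hx, hx'.2⟩
        simp [hECD] at this)
    obtain ⟨d, hDd, hd⟩ := H.interpolate (D n) ((E ∩ h c)ᶜ ∩ (h (b n))ᶜ) (hD n)
      ((hEc.inter (H.isClosed c)).isOpen_compl.inter (H.isClosed _).isOpen_compl) (by
        intro x hx
        exact ⟨fun hx' => (hc hx'.2).1 ⟨hx'.1, hx⟩, fun hx' => (hDb n).le_bot ⟨hx, hx'⟩⟩)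
    refine ⟨c, d, ⟨?_, ?_, ?_⟩, ih _ ?_⟩
    · rw [← H.eq_univ_iff, H.map_sup]
      exact Set.eq_univ_of_univ_subset ((hCD n).symm.subset.trans (Set.union_subset_union hCc hDd))
    · rw [← H.disjoint_iff]
      exact Set.disjoint_left.2 fun x hx => (hc hx).2
    · rw [← H.disjoint_iff]
      exact Set.disjoint_left.2 fun x hx => (hd hx).2
    · rw [Set.eq_empty_iff_forall_notMem]
      rintro x ⟨hx, hx'⟩
      rw [H.map_inf, H.map_inf] at hx
      exact (hd hx.2.2).1 ⟨⟨hx.1, hx'⟩, hx.2.1⟩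

/-- In a compact Hausdorff space weak infinite dimension can be tested on a lattice base for the
closed sets, and each instance of it is a statement about finitely many members of the base. -/
theorem weaklyInfiniteDimensional_iff [CompactSpace Y] [T2Space Y] (H : IsClosedBase h) :
    WeaklyInfiniteDimensional Y ↔
      ∀ a b : ℕ → L, (∀ i, a i ⊓ b i = ⊥) → ∃ n, HasEmptyPartition n a b ⊤ := by
  constructor
  · intro hY a b hab
    obtain ⟨S, hS, hSe⟩ := hY (fun i => h (a i)) (fun i => h (b i)) (fun i => H.isClosed _)
      (fun i => H.isClosed _) (fun i => H.disjoint_iff.2 (hab i))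
    choose U V hU hV hAU hBV hUV hSUV using hS
    have hS' : ∀ i, S i = (U i)ᶜ ∩ (V i)ᶜ := fun i => by
      rw [← Set.compl_union, ← hSUV, compl_compl]
    obtain ⟨t, ht⟩ := isCompact_univ.elim_finite_subfamily_closed S
      (fun i => hS' i ▸ (hU i).isClosed_compl.inter (hV i).isClosed_compl) (by simp [hSe])
    obtain ⟨n, hn⟩ := t.exists_nat_subset_range
    refine ⟨n, H.hasEmptyPartition (C := fun i => (U i)ᶜ) (D := fun i => (V i)ᶜ)
      (fun i => (hU i).isClosed_compl) (fun i => (hV i).isClosed_compl) ?_ ?_ ?_ n ⊤ ?_⟩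
    · intro i
      rw [← Set.compl_inter, (hUV i).inter_eq, Set.compl_empty]
    · exact fun i => Set.disjoint_left.2 fun x hx hx' => hx (hAU i hx')
    · exact fun i => Set.disjoint_left.2 fun x hx hx' => hx (hBV i hx')
    · rw [Set.eq_empty_iff_forall_notMem]
      rintro x ⟨-, hx⟩
      have : x ∈ Set.univ ∩ ⋂ i ∈ t, S i := by
        refine ⟨trivial, Set.mem_iInter₂.2 fun i hi => ?_⟩
        rw [hS']
        exact Set.mem_iInter₂.1 hx i (Finset.mem_range.1 (hn hi))
      simp [ht] at this
  · intro hL A B hA hB hAB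
    choose a hAa ha using fun i => H.interpolate (A i) (B i)ᶜ (hA i) (hB i).isOpen_compl
      (Set.disjoint_left.1 (hAB i))
    choose b hBb hb using fun i => H.interpolate (B i) (h (a i))ᶜ (hB i) (H.isClosed _).isOpen_compl
      (fun x hx hx' => ha i hx' hx)
    obtain ⟨n, hn⟩ := hL a b fun i => H.disjoint_iff.1 (Set.disjoint_left.2 fun x hx hx' =>
      hb i hx' hx)
    obtain ⟨c, d, hcd, he⟩ := hasEmptyPartition_iff.1 hn
    choose S hS using fun i => exists_isPartitionBetween (hA i) (hB i) (hAB i)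
    refine ⟨fun i => if i < n then h (c i) ∩ h (d i) else S i, fun i => ?_, ?_⟩
    · by_cases hi : i < n
      · simp only [hi, if_true]
        obtain ⟨h1, h2, h3⟩ := hcd i hi
        refine ⟨(h (c i))ᶜ, (h (d i))ᶜ, (H.isClosed _).isOpen_compl, (H.isClosed _).isOpen_compl,
          fun x hx hx' => ?_, fun x hx hx' => ?_, ?_, Set.compl_inter _ _⟩
        · exact (H.disjoint_iff.2 h2).le_bot ⟨hx', hAa i hx⟩
        · exact (H.disjoint_iff.2 h3).le_bot ⟨hx', hBb i hx⟩
        · rw [Set.disjoint_iff_inter_eq_empty, ← Set.compl_union, ← H.map_sup, h1,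
            H.map_top, Set.compl_univ]
      · simpa only [hi, if_false] using hS i
    · rw [top_inf_eq] at he
      rw [← Set.subset_empty_iff, ← (H.eq_empty_iff _).2 he, H.map_finset_inf]
      refine Set.subset_iInter₂ fun i hi x hx => ?_
      have := Set.mem_iInter.1 hx i
      rw [H.map_inf]
      simpa only [hi, if_true] using this

theorem isNormalLattice (H : IsClosedBase h) [NormalSpace Y] : IsNormalLattice L := by
  intro a b hab
  obtain ⟨U, V, hU, hV, haU, hbV, hUV⟩ :=
    normal_separation (H.isClosed a) (H.isClosed b) (H.disjoint_iff.2 hab)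
  obtain ⟨c, d, hcd, -⟩ := H.hasEmptyPartition (a := fun _ => a) (b := fun _ => b)
    (C := fun _ => Uᶜ) (D := fun _ => Vᶜ) (fun _ => hU.isClosed_compl) (fun _ => hV.isClosed_compl)
    (fun _ => by rw [← Set.compl_inter, hUV.inter_eq, Set.compl_empty])
    (fun _ => Set.disjoint_left.2 fun x hx hx' => hx (haU hx'))
    (fun _ => Set.disjoint_left.2 fun x hx hx' => hx (hbV hx'))
    1 ⊥ (by rw [H.map_bot, Set.empty_inter])
  exact ⟨c, d, hcd⟩

theorem isSeparativeLattice (H : IsClosedBase h) [T1Space Y] : IsSeparativeLattice L := by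
  intro a b hab
  obtain ⟨x, hxa, hxb⟩ := Set.not_subset.1 fun h => hab (H.le_of_subset _ _ h)
  obtain ⟨c, hxc, hcb⟩ := H.interpolate {x} (h b)ᶜ isClosed_singleton (H.isClosed b).isOpen_compl
    (Set.singleton_subset_iff.2 hxb)
  refine ⟨c ⊓ a, fun hca => ?_, inf_le_right, ?_⟩
  · have : x ∈ h (c ⊓ a) := by
      rw [H.map_inf]
      exact ⟨hxc rfl, hxa⟩
    rw [hca, H.map_bot] at this
    exact this
  · rw [← H.disjoint_iff, H.map_inf]
    exact Set.disjoint_left.2 fun y hy => hcb hy.1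

end IsClosedBase

theorem isClosedBase_closeds (X : Type*) [TopologicalSpace X] :
    IsClosedBase (fun a : Closeds X => (a : Set X)) where
  isClosed a := a.isClosed
  map_inf _ _ := rfl
  map_sup _ _ := rfl
  map_bot := rfl
  map_top := rfl
  le_of_subset _ _ h := h
  interpolate A _ hA _ h := ⟨⟨A, hA⟩, subset_rfl, h⟩

/-! ### The Wallman space of a normal distributive lattice -/

namespace WallmanSpace

open Order

section Filters

variable {L : Type*} [Lattice L]

/-- The filter generated by a nonempty set closed under meets. -/
theorem exists_pfilter (s : Set L) (hs : s.Nonempty) (hinf : ∀ a ∈ s, ∀ b ∈ s, a ⊓ b ∈ s) :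
    ∃ F : PFilter L, ∀ a, a ∈ F ↔ ∃ b ∈ s, b ≤ a := by
  have : IsPFilter {a | ∃ b ∈ s, b ≤ a} := by
    refine IsPFilter.of_def ?_ ?_ ?_
    · obtain ⟨b, hb⟩ := hs
      exact ⟨b, b, hb, le_rfl⟩
    · rintro a ⟨a', ha', haa⟩ b ⟨b', hb', hbb⟩
      exact ⟨a' ⊓ b', ⟨_, hinf _ ha' _ hb', le_rfl⟩, inf_le_left.trans haa, inf_le_right.trans hbb⟩
    · rintro a b hab ⟨c, hc, hca⟩
      exact ⟨c, hc, hca.trans hab⟩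
  exact ⟨this.toPFilter, fun a => Iff.rfl⟩

theorem ext {u v : WallmanSpace L} (h : u.1 ≤ v.1) : u = v :=
  Subtype.ext (le_antisymm h (u.2.2 v.2.1 h))

theorem isClosed_hat (a : L) : IsClosed (hat a) :=
  ⟨isOpen_generateFrom_of_mem ⟨a, rfl⟩⟩

theorem hat_inf (a b : L) : hat (a ⊓ b) = hat a ∩ hat b :=
  Set.ext fun _ => PFilter.inf_mem_iff

variable [BoundedOrder L]

theorem ne_univ_iff {F : PFilter L} : (F : Set L) ≠ Set.univ ↔ ⊥ ∉ F := by
  rw [Ne, not_iff_not]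
  exact ⟨fun h => by rw [← SetLike.mem_coe, h]; trivial,
    fun h => Set.eq_univ_of_forall fun a => F.mem_of_le bot_le h⟩

theorem bot_notMem (u : WallmanSpace L) : ⊥ ∉ u.1 := ne_univ_iff.1 u.2.1

/-- Every set of elements that is closed under meets and omits `⊥` lies in an ultrafilter. -/
theorem exists_forall_mem (s : Set L) (hinf : ∀ a ∈ s, ∀ b ∈ s, a ⊓ b ∈ s) (hbot : ⊥ ∉ s)
    (hs : s.Nonempty) : ∃ u : WallmanSpace L, ∀ a ∈ s, a ∈ u.1 := by
  obtain ⟨F, hF⟩ := exists_pfilter s hs hinf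
  have hFp : (F : Set L) ≠ Set.univ := by
    rw [ne_univ_iff, hF]
    rintro ⟨b, hb, hb'⟩
    exact hbot (le_bot_iff.1 hb' ▸ hb)
  obtain ⟨u, hu, hmax⟩ := zorn_le_nonempty₀ {F : PFilter L | (F : Set L) ≠ Set.univ} (by
    intro c hc hchain y hy
    have hdir : DirectedOn (· ≤ ·) c := hchain.directedOn
    obtain ⟨G, hG⟩ := exists_pfilter {a | ∃ F ∈ c, a ∈ F} ⟨⊤, y, hy, PFilter.top_mem⟩ (by
      rintro a ⟨F, hF, ha⟩ b ⟨F', hF', hb⟩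
      obtain ⟨F'', hF'', h1, h2⟩ := hdir F hF F' hF'
      exact ⟨F'', hF'', PFilter.inf_mem (h1 ha) (h2 hb)⟩)
    refine ⟨G, ?_, fun F hF a ha => (hG a).2 ⟨a, ⟨F, hF, ha⟩, le_rfl⟩⟩
    rw [Set.mem_ofPred_eq, ne_univ_iff, hG]
    rintro ⟨b, ⟨F, hF, hb⟩, hb'⟩
    exact ne_univ_iff.1 (hc hF) (le_bot_iff.1 hb' ▸ hb)) F hFp
  exact ⟨⟨u, hmax⟩, fun a ha => hu ((hF a).2 ⟨a, ha, le_rfl⟩)⟩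

/-- By maximality, an ultrafilter omits exactly those elements that are disjoint from one of its
members. -/
theorem notMem_iff {u : WallmanSpace L} {a : L} : a ∉ u.1 ↔ ∃ b ∈ u.1, b ⊓ a = ⊥ := by
  constructor
  · intro ha
    by_contra! hcon
    obtain ⟨F, hF⟩ := exists_pfilter {c | ∃ b ∈ u.1, c = b ⊓ a} ⟨_, ⊤, PFilter.top_mem, rfl⟩ (by
      rintro _ ⟨b, hb, rfl⟩ _ ⟨b', hb', rfl⟩
      exact ⟨b ⊓ b', PFilter.inf_mem hb hb', by rw [← inf_inf_distrib_right]⟩)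
    have hFp : (F : Set L) ≠ Set.univ := by
      rw [ne_univ_iff, hF]
      rintro ⟨_, ⟨b, hb, rfl⟩, hb'⟩
      exact hcon b hb (le_bot_iff.1 hb')
    have huF : u.1 ≤ F := fun b hb => (hF b).2 ⟨_, ⟨b, hb, rfl⟩, inf_le_left⟩
    exact ha (u.2.2 hFp huF ((hF a).2 ⟨_, ⟨⊤, PFilter.top_mem, rfl⟩, inf_le_right⟩))
  · rintro ⟨b, hb, hba⟩ ha
    exact bot_notMem u (hba ▸ PFilter.inf_mem hb ha)

theorem hat_top : hat (⊤ : L) = Set.univ := Set.eq_univ_of_forall fun _ => PFilter.top_mem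

theorem hat_eq_empty_iff {a : L} : hat a = ∅ ↔ a = ⊥ := by
  constructor
  · intro h
    by_contra ha
    obtain ⟨u, hu⟩ := exists_forall_mem {a} (by simp) (by simpa using Ne.symm ha) ⟨a, rfl⟩
    exact Set.eq_empty_iff_forall_notMem.1 h u (hu a rfl)
  · rintro rfl
    exact Set.eq_empty_iff_forall_notMem.2 bot_notMem

theorem le_of_hat_subset (hL : IsSeparativeLattice L) {a b : L} (h : hat a ⊆ hat b) : a ≤ b := by
  by_contra hab
  obtain ⟨c, hc, hca, hcb⟩ := hL a b hab
  refine hc (hat_eq_empty_iff.1 (Set.eq_empty_iff_forall_notMem.2 fun u hu => ?_))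
  exact notMem_iff.2 ⟨c, hu, hcb⟩ (h (u.1.mem_of_le hca hu))

instance : CompactSpace (WallmanSpace L) := by
  refine ⟨isCompact_iff_ultrafilter_le_nhds.2 fun G _ => ?_⟩
  obtain ⟨u, hu⟩ := exists_forall_mem {a : L | hat a ∈ G}
    (fun a ha b hb => by
      rw [Set.mem_ofPred_eq, hat_inf]
      exact Filter.inter_mem ha hb)
    (fun h => by
      rw [Set.mem_ofPred_eq, hat_eq_empty_iff.2 rfl] at h
      exact Filter.empty_notMem _ h)
    ⟨⊤, by rw [Set.mem_ofPred_eq, hat_top]; exact Filter.univ_mem⟩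
  refine ⟨u, trivial, ?_⟩
  rw [nhds_generateFrom]
  refine le_iInf₂ fun s hs => ?_
  obtain ⟨hus, a, rfl⟩ := hs
  rw [Filter.le_principal_iff]
  exact Ultrafilter.compl_mem_iff_notMem.2 fun ha => hus (hu a ha)

end Filters

section Distrib

variable {L : Type*} [DistribLattice L] [BoundedOrder L]

theorem hat_sup (a b : L) : hat (a ⊔ b) = hat a ∪ hat b := by
  ext u
  constructor
  · intro h
    by_contra hn
    obtain ⟨ha, hb⟩ := not_or.1 hn
    obtain ⟨f, hf, hfa⟩ := notMem_iff.1 ha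
    obtain ⟨g, hg, hgb⟩ := notMem_iff.1 hb
    have hfg : f ⊓ g ⊓ (a ⊔ b) = ⊥ := by
      rw [inf_sup_left, inf_right_comm, hfa, inf_assoc, hgb, bot_inf_eq, inf_bot_eq, bot_sup_eq]
    exact notMem_iff.2 ⟨f ⊓ g, PFilter.inf_mem hf hg, hfg⟩ h
  · rintro (h | h)
    · exact u.1.mem_of_le le_sup_left h
    · exact u.1.mem_of_le le_sup_right h

theorem isTopologicalBasis : IsTopologicalBasis {U : Set (WallmanSpace L) | ∃ a, U = (hat a)ᶜ} where
  exists_subset_inter := by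
    rintro _ ⟨a, rfl⟩ _ ⟨b, rfl⟩ x hx
    exact ⟨_, ⟨a ⊔ b, rfl⟩, by rwa [hat_sup, Set.compl_union], by rw [hat_sup, Set.compl_union]⟩
  sUnion_eq := Set.eq_univ_of_forall fun u =>
    ⟨_, ⟨⊥, rfl⟩, by rw [hat_eq_empty_iff.2 rfl]; exact Set.notMem_empty u⟩
  eq_generateFrom := rfl

theorem t2Space (hL : IsNormalLattice L) : T2Space (WallmanSpace L) := by
  refine ⟨fun u v huv => ?_⟩
  obtain ⟨a, hau, hav⟩ := Set.not_subset.1 (fun h => huv (ext h))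
  obtain ⟨b, hbv, hba⟩ := notMem_iff.1 hav
  obtain ⟨c, d, h1, h2, h3⟩ := hL a b (by rwa [inf_comm])
  refine ⟨(hat c)ᶜ, (hat d)ᶜ, (isClosed_hat c).isOpen_compl, (isClosed_hat d).isOpen_compl,
    notMem_iff.2 ⟨a, hau, by rwa [inf_comm]⟩, notMem_iff.2 ⟨b, hbv, by rwa [inf_comm]⟩, ?_⟩
  rw [Set.disjoint_iff_inter_eq_empty, ← Set.compl_union, ← hat_sup, h1, hat_top, Set.compl_univ]

theorem isClosedBase_hat (hL : IsSeparativeLattice L) : IsClosedBase (hat : L → Set _) where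
  isClosed := isClosed_hat
  map_inf := hat_inf
  map_sup := hat_sup
  map_bot := hat_eq_empty_iff.2 rfl
  map_top := hat_top
  le_of_subset _ _ := le_of_hat_subset hL
  interpolate A O hA hO hAO := by
    obtain ⟨a, haA, ha⟩ := hO.isClosed_compl.isCompact.induction_on
      (p := fun s => ∃ a : L, A ⊆ hat a ∧ Disjoint s (hat a))
      ⟨⊤, by simp [hat_top], Set.empty_disjoint _⟩
      (fun s t hst ⟨a, ha, hd⟩ => ⟨a, ha, hd.mono_left hst⟩)
      (fun s t ⟨a, ha, hd⟩ ⟨b, hb, hd'⟩ => ⟨a ⊓ b, by rw [hat_inf]; exact Set.subset_inter ha hb, by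
        rw [hat_inf]
        exact Disjoint.union_left (hd.mono_right Set.inter_subset_left)
          (hd'.mono_right Set.inter_subset_right)⟩)
      (fun x hx => by
        obtain ⟨_, ⟨a, rfl⟩, hxa, haA⟩ := isTopologicalBasis.exists_subset_of_mem_open
          (show x ∈ Aᶜ from fun h => hx (hAO h)) hA.isOpen_compl
        exact ⟨(hat a)ᶜ, mem_nhdsWithin_of_mem_nhds ((isClosed_hat a).isOpen_compl.mem_nhds hxa),
          a, Set.compl_subset_compl.1 haA, disjoint_compl_left⟩)
    exact ⟨a, haA, fun x hx => by_contra fun hxO => ha.le_bot ⟨hxO, hx⟩⟩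

theorem weaklyInfiniteDimensional_iff (hn : IsNormalLattice L) (hs : IsSeparativeLattice L) :
    WeaklyInfiniteDimensional (WallmanSpace L) ↔
      ∀ a b : ℕ → L, (∀ i, a i ⊓ b i = ⊥) → ∃ n, HasEmptyPartition n a b ⊤ :=
  have := t2Space hn
  (isClosedBase_hat hs).weaklyInfiniteDimensional_iff

end Distrib

end WallmanSpace

/-! ### Definable predicates and elementary substructures -/

open FirstOrder

/-- The predicate `R` on assignments of values to the variables `α` is given by a first-order
formula without parameters. -/
def IsFODefinable (𝓛 : FirstOrder.Language.{0, 0}) {N : Type*} [𝓛.Structure N] {α : Type}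
    (R : (α → N) → Prop) : Prop :=
  ∃ φ : 𝓛.Formula α, ∀ v, φ.Realize v ↔ R v

/-- Existential quantification over the variable `none`. -/
noncomputable def FirstOrder.Language.Formula.exNone {𝓛 : FirstOrder.Language.{0, 0}} {α : Type}
    (φ : 𝓛.Formula (Option α)) : 𝓛.Formula α :=
  (φ.relabel (fun o : Option α => o.elim (Sum.inr ()) Sum.inl)).iExs Unit

namespace IsFODefinable

open FirstOrder.Language

variable {𝓛 : FirstOrder.Language.{0, 0}} {N : Type*} [𝓛.Structure N] {α : Type}
  {R R' : (α → N) → Prop}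

theorem realize_exNone {φ : 𝓛.Formula (Option α)} {v : α → N} :
    φ.exNone.Realize v ↔ ∃ x : N, φ.Realize (fun o : Option α => o.elim x v) := by
  have key : ∀ i : Unit → N, (Sum.elim v i ∘ fun o : Option α => o.elim (Sum.inr ()) Sum.inl) =
      fun o : Option α => o.elim (i ()) v := fun i => by
    funext o
    cases o <;> rfl
  rw [Formula.exNone, Formula.realize_iExs]
  simp only [Formula.realize_relabel, key]
  exact ⟨fun ⟨i, hi⟩ => ⟨i (), hi⟩, fun ⟨x, hx⟩ => ⟨fun _ => x, hx⟩⟩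

theorem not (h : IsFODefinable 𝓛 R) : IsFODefinable 𝓛 (fun v => ¬ R v) := by
  obtain ⟨φ, hφ⟩ := h
  exact ⟨φ.not, fun v => by rw [Formula.realize_not, hφ]⟩

theorem and (h : IsFODefinable 𝓛 R) (h' : IsFODefinable 𝓛 R') :
    IsFODefinable 𝓛 (fun v => R v ∧ R' v) := by
  obtain ⟨φ, hφ⟩ := h
  obtain ⟨ψ, hψ⟩ := h'
  exact ⟨φ ⊓ ψ, fun v => by rw [Formula.realize_inf, hφ, hψ]⟩

theorem imp (h : IsFODefinable 𝓛 R) (h' : IsFODefinable 𝓛 R') :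
    IsFODefinable 𝓛 (fun v => R v → R' v) := by
  obtain ⟨φ, hφ⟩ := h
  obtain ⟨ψ, hψ⟩ := h'
  exact ⟨φ.imp ψ, fun v => by rw [Formula.realize_imp, hφ, hψ]⟩

theorem or (h : IsFODefinable 𝓛 R) (h' : IsFODefinable 𝓛 R') :
    IsFODefinable 𝓛 (fun v => R v ∨ R' v) := by
  simpa only [not_imp_not, ← or_iff_not_imp_left] using h.not.imp h'

theorem iff (h : IsFODefinable 𝓛 R) (h' : IsFODefinable 𝓛 R') :
    IsFODefinable 𝓛 (fun v => R v ↔ R' v) := by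
  simpa only [iff_def] using (h.imp h').and (h'.imp h)

theorem ex {R : (α → N) → N → Prop}
    (h : IsFODefinable 𝓛 (fun w : Option α → N => R (fun a => w (some a)) (w none))) :
    IsFODefinable 𝓛 (fun v : α → N => ∃ x : N, R v x) := by
  obtain ⟨φ, hφ⟩ := h
  exact ⟨φ.exNone, fun v => realize_exNone.trans (exists_congr fun x => hφ _)⟩

theorem all {R : (α → N) → N → Prop}
    (h : IsFODefinable 𝓛 (fun w : Option α → N => R (fun a => w (some a)) (w none))) :
    IsFODefinable 𝓛 (fun v : α → N => ∀ x : N, R v x) := by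
  simpa only [not_exists, not_not] using (ex (R := fun v x => ¬ R v x) h.not).not

/-- A definable condition with parameters in an elementary substructure that has a solution has
one in the substructure. -/
theorem exists_mem {R : (α → N) → N → Prop}
    (h : IsFODefinable 𝓛 (fun w : Option α → N => R (fun a => w (some a)) (w none)))
    (S : 𝓛.ElementarySubstructure N) {v : α → N} (hv : ∀ a, v a ∈ S) (hx : ∃ x, R v x) :
    ∃ x ∈ S, R v x := by
  obtain ⟨φ, hφ⟩ := h
  have h1 : φ.exNone.Realize (S.subtype ∘ fun a => ⟨v a, hv a⟩) :=
    realize_exNone.2 (hx.imp fun x hx => (hφ _).2 hx)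
  rw [S.subtype.map_formula] at h1
  obtain ⟨x, hx⟩ := realize_exNone.1 h1
  rw [← S.subtype.map_formula, hφ] at hx
  exact ⟨x, x.2, hx⟩

end IsFODefinable

/-! ### Elementary sublattices -/

/-- The function `f` of the variables `α` is given by a term of the language of lattices. -/
def IsLatticeTerm {K : Type*} [Lattice K] [BoundedOrder K] {α : Type} (f : (α → K) → K) : Prop :=
  ∃ t : latticeLanguage.Term α, ∀ v, t.realize v = f v

namespace IsLatticeTerm

open FirstOrder.Language

variable {K : Type*} [Lattice K] [BoundedOrder K] {α : Type} {f g : (α → K) → K}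

theorem var (a : α) : IsLatticeTerm (fun v : α → K => v a) := ⟨Term.var a, fun _ => rfl⟩

theorem bot : IsLatticeTerm (fun _ : α → K => ⊥) :=
  ⟨Term.func (LatticeFunc.bot : latticeLanguage.Functions 0) ![], fun _ => rfl⟩

theorem top : IsLatticeTerm (fun _ : α → K => ⊤) :=
  ⟨Term.func (LatticeFunc.top : latticeLanguage.Functions 0) ![], fun _ => rfl⟩

theorem inf (hf : IsLatticeTerm f) (hg : IsLatticeTerm g) : IsLatticeTerm (fun v => f v ⊓ g v) := by
  obtain ⟨s, hs⟩ := hf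
  obtain ⟨t, ht⟩ := hg
  exact ⟨Term.func (LatticeFunc.inf : latticeLanguage.Functions 2) ![s, t], fun v =>
    congrArg₂ (· ⊓ ·) (hs v) (ht v)⟩

theorem sup (hf : IsLatticeTerm f) (hg : IsLatticeTerm g) : IsLatticeTerm (fun v => f v ⊔ g v) := by
  obtain ⟨s, hs⟩ := hf
  obtain ⟨t, ht⟩ := hg
  exact ⟨Term.func (LatticeFunc.sup : latticeLanguage.Functions 2) ![s, t], fun v =>
    congrArg₂ (· ⊔ ·) (hs v) (ht v)⟩

theorem weaken (hf : IsLatticeTerm f) :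
    IsLatticeTerm (fun w : Option α → K => f (fun a => w (some a))) := by
  obtain ⟨s, hs⟩ := hf
  exact ⟨s.relabel some, fun w => by rw [Term.realize_relabel, hs]; rfl⟩

theorem eq (hf : IsLatticeTerm f) (hg : IsLatticeTerm g) :
    IsFODefinable latticeLanguage (fun v => f v = g v) := by
  obtain ⟨s, hs⟩ := hf
  obtain ⟨t, ht⟩ := hg
  exact ⟨s.equal t, fun v => by rw [Formula.realize_equal, hs, ht]⟩

theorem isPartitionPair {f' g' : (α → K) → K} (hf : IsLatticeTerm f) (hg : IsLatticeTerm g)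
    (hf' : IsLatticeTerm f') (hg' : IsLatticeTerm g') :
    IsFODefinable latticeLanguage (fun v => IsPartitionPair (f v) (g v) (f' v) (g' v)) :=
  ((hf'.sup hg').eq top).and (((hf'.inf hf).eq bot).and ((hg'.inf hg).eq bot))

theorem hasEmptyPartition (n : ℕ) {α : Type} (a b : ℕ → α) {y : (α → K) → K}
    (hy : IsLatticeTerm y) : IsFODefinable latticeLanguage
      (fun v => HasEmptyPartition n (fun i => v (a i)) (fun i => v (b i)) (y v)) := by
  induction n generalizing α with
  | zero => exact hy.eq bot
  | succ n ih =>
    refine .ex (.ex (.and ?_ ?_))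
    · exact isPartitionPair (var _) (var _) (var _) (var _)
    · exact ih (fun i => some (some (a i))) (fun i => some (some (b i)))
        (hy.weaken.weaken.inf ((var (some none)).inf (var none)))

end IsLatticeTerm

namespace ElementarySublattice

open FirstOrder.Language

variable {K : Type*} [DistribLattice K] [BoundedOrder K]

theorem funMap_mem (L : latticeLanguage.ElementarySubstructure K) {n : ℕ}
    (f : latticeLanguage.Functions n) (x : Fin n → K) (hx : ∀ i, x i ∈ L) :
    Structure.funMap f x ∈ L :=
  L.toSubstructure.fun_mem f x hx

/-- The lattice operations of an elementary sublattice, extending its order. -/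
instance (L : latticeLanguage.ElementarySubstructure K) : DistribLattice L where
  sup a b := ⟨a.1 ⊔ b.1, funMap_mem L LatticeFunc.sup ![a.1, b.1] (by simp [Fin.forall_fin_two])⟩
  inf a b := ⟨a.1 ⊓ b.1, funMap_mem L LatticeFunc.inf ![a.1, b.1] (by simp [Fin.forall_fin_two])⟩
  le_sup_left a b := le_sup_left (a := a.1) (b := b.1)
  le_sup_right a b := le_sup_right (a := a.1) (b := b.1)
  sup_le a b c h h' := sup_le (a := a.1) (b := b.1) (c := c.1) h h'
  inf_le_left a b := inf_le_left (a := a.1) (b := b.1)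
  inf_le_right a b := inf_le_right (a := a.1) (b := b.1)
  le_inf a b c h h' := show a.1 ≤ b.1 ⊓ c.1 from le_inf h h'
  le_sup_inf a b c := le_sup_inf (x := a.1) (y := b.1) (z := c.1)

instance (L : latticeLanguage.ElementarySubstructure K) : BoundedOrder L where
  top := ⟨⊤, funMap_mem L LatticeFunc.top ![] (by simp)⟩
  bot := ⟨⊥, funMap_mem L LatticeFunc.bot ![] (by simp)⟩
  le_top a := le_top (a := a.1)
  bot_le a := bot_le (a := a.1)

theorem isPartitionPair_coe (L : latticeLanguage.ElementarySubstructure K) {a b c d : L} :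
    IsPartitionPair (a : K) b c d ↔ IsPartitionPair a b c d :=
  ⟨fun h => ⟨Subtype.ext h.1, Subtype.ext h.2.1, Subtype.ext h.2.2⟩, fun h =>
    ⟨congrArg Subtype.val h.1, congrArg Subtype.val h.2.1, congrArg Subtype.val h.2.2⟩⟩

/-- If partitions with empty intersection exist in the whole lattice, then they exist in every
elementary sublattice containing the given elements. -/
theorem hasEmptyPartition (L : latticeLanguage.ElementarySubstructure K) {n : ℕ} {a b : ℕ → L}
    {y : L} (h : HasEmptyPartition n (fun i => (a i : K)) (fun i => (b i : K)) (y : K)) :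
    HasEmptyPartition n a b y := by
  induction n generalizing y with
  | zero => exact Subtype.ext h
  | succ n ih =>
    obtain ⟨c, hcL, d, hd⟩ := IsFODefinable.exists_mem (α := Option (ℕ ⊕ ℕ))
      (R := fun v c => ∃ d, IsPartitionPair (v (some (Sum.inl n))) (v (some (Sum.inr n))) c d ∧
        HasEmptyPartition n (fun i => v (some (Sum.inl i))) (fun i => v (some (Sum.inr i)))
          (v none ⊓ (c ⊓ d)))
      (.ex (.and (IsLatticeTerm.isPartitionPair (.var _) (.var _) (.var _) (.var _))
        (IsLatticeTerm.hasEmptyPartition n (fun i => some (some (some (Sum.inl i))))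
          (fun i => some (some (some (Sum.inr i))))
          ((IsLatticeTerm.var _).inf ((IsLatticeTerm.var _).inf (.var _))))))
      L (v := fun o => o.elim y (Sum.elim (fun i => (a i : K)) (fun i => (b i : K))))
      (by rintro (_ | _ | _) <;> simp) h
    obtain ⟨d, hdL, h1, h2⟩ := IsFODefinable.exists_mem (α := Option (Option (ℕ ⊕ ℕ)))
      (R := fun v d => IsPartitionPair (v (some (some (Sum.inl n)))) (v (some (some (Sum.inr n))))
          (v none) d ∧
        HasEmptyPartition n (fun i => v (some (some (Sum.inl i)))) (fun i => v (some (some (Sum.inr i))))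
          (v (some none) ⊓ (v none ⊓ d)))
      (.and (IsLatticeTerm.isPartitionPair (.var _) (.var _) (.var _) (.var _))
        (IsLatticeTerm.hasEmptyPartition n (fun i => some (some (some (Sum.inl i))))
          (fun i => some (some (some (Sum.inr i))))
          ((IsLatticeTerm.var _).inf ((IsLatticeTerm.var _).inf (.var _)))))
      L (v := fun o => o.elim c
        (fun o => o.elim y (Sum.elim (fun i => (a i : K)) (fun i => (b i : K)))))
      (by rintro (_ | _ | _ | _) <;> simp [hcL]) ⟨d, hd⟩
    exact ⟨⟨c, hcL⟩, ⟨d, hdL⟩, (isPartitionPair_coe L).1 h1, ih h2⟩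

theorem isNormalLattice (hK : IsNormalLattice K) (L : latticeLanguage.ElementarySubstructure K) :
    IsNormalLattice L := by
  intro a b hab
  obtain ⟨c, d, hcd⟩ := hK a b (congrArg Subtype.val hab)
  obtain ⟨c, d, hcd, -⟩ := hasEmptyPartition L (n := 1) (a := fun _ => a) (b := fun _ => b) (y := ⊥)
    ⟨c, d, hcd, bot_inf_eq _⟩
  exact ⟨c, d, hcd⟩

theorem isSeparativeLattice (hK : IsSeparativeLattice K)
    (L : latticeLanguage.ElementarySubstructure K) : IsSeparativeLattice L := by
  intro a b hab
  obtain ⟨c, hcL, h1, h2, h3⟩ := IsFODefinable.exists_mem (α := Bool)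
    (R := fun v c => ¬ c = ⊥ ∧ c ⊓ v true = c ∧ c ⊓ v false = ⊥)
    (((IsLatticeTerm.var none).eq .bot).not.and
      ((((IsLatticeTerm.var none).inf (.var (some true))).eq (.var none)).and
        (((IsLatticeTerm.var none).inf (.var (some false))).eq .bot)))
    L (v := fun i => if i then (a : K) else b) (by rintro (_ | _) <;> simp)
    (by simpa using hK a b hab)
  exact ⟨⟨c, hcL⟩, fun h => h1 (congrArg Subtype.val h),
    show c ≤ (a : K) from inf_eq_left.1 h2, Subtype.ext h3⟩

end ElementarySublattice

theorem elementarilyReflected_weaklyInfiniteDimensional :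
    ElementarilyReflected.{u} (fun Y _ => WeaklyInfiniteDimensional Y) := by
  intro X _ _ _ hX L
  have hn := ElementarySublattice.isNormalLattice (isClosedBase_closeds X).isNormalLattice L
  have hs := ElementarySublattice.isSeparativeLattice (isClosedBase_closeds X).isSeparativeLattice L
  refine (WallmanSpace.weaklyInfiniteDimensional_iff hn hs).2 fun a b hab => ?_
  obtain ⟨n, h⟩ := (isClosedBase_closeds X).weaklyInfiniteDimensional_iff.1 hX
    (fun i => a i) (fun i => b i) fun i => congrArg Subtype.val (hab i)
  exact ⟨n, ElementarySublattice.hasEmptyPartition L h⟩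

/-! ### Definability in the language of set theory -/

section SetPredicates

variable {N : Set ZFSet.{u}}

/-- `a ∩ b = ∅`, as a statement about the structure `N`. -/
def SetDisjoint (a b : N) : Prop := ¬ ∃ x : N, x.1 ∈ a.1 ∧ x.1 ∈ b.1

/-- `c`, `d` is a partition pair between `a` and `b` in the lattice `z`, as a statement about the
structure `N`. -/
def SetPartitionPair (z a b c d : N) : Prop :=
  c.1 ∈ z.1 ∧ d.1 ∈ z.1 ∧ (∀ f : N, f.1 ∈ z.1 → ∀ x : N, x.1 ∈ f.1 → x.1 ∈ c.1 ∨ x.1 ∈ d.1) ∧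
    SetDisjoint c a ∧ SetDisjoint d b

/-- `w = y ∩ c ∩ d`, as a statement about the structure `N`. -/
def IsSetInter (w y c d : N) : Prop :=
  ∀ x : N, x.1 ∈ w.1 ↔ x.1 ∈ y.1 ∧ x.1 ∈ c.1 ∧ x.1 ∈ d.1

/-- The statement `HasEmptyPartition` about the lattice `z`, relativized to the structure `N`. -/
def SetHasEmptyPartition (z : N) : ℕ → (ℕ → N) → (ℕ → N) → N → Prop
  | 0, _, _, y => ¬ ∃ x : N, x.1 ∈ y.1
  | n + 1, a, b, y => ∃ c d w : N, SetPartitionPair z (a n) (b n) c d ∧ IsSetInter w y c d ∧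
      SetHasEmptyPartition z n a b w

/-- Members of `K` are taken to members of `K'` by intersecting them with the partitions between
`a` and `b`. -/
def SetStep (z a b K K' : N) : Prop :=
  ∀ y c d w : N, y.1 ∈ K.1 → SetPartitionPair z a b c d → IsSetInter w y c d → w.1 ∈ K'.1

/-- `K'` is a successor of `K` in `T`, by means of the disjoint members `a` and `b` of `z`. -/
def SetSuccessor (z T K a b K' : N) : Prop :=
  a.1 ∈ z.1 ∧ b.1 ∈ z.1 ∧ SetDisjoint a b ∧ K'.1 ∈ T.1 ∧ SetStep z a b K K'

/-- `T` is a witness to strong infinite dimension that does not mention natural numbers or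
sequences: a set of families of nonempty closed sets, each of which has a successor in `T`. -/
def IsEssentialTree (z T : N) : Prop :=
  ∀ K : N, K.1 ∈ T.1 → (∀ w : N, w.1 ∈ K.1 → ∃ x : N, x.1 ∈ w.1) ∧
    ∃ a b K' : N, SetSuccessor z T K a b K'

/-- `K` has the largest member of `z` as a member. -/
def ContainsTop (z K : N) : Prop :=
  ∃ y : N, y.1 ∈ K.1 ∧ y.1 ∈ z.1 ∧ ∀ f : N, f.1 ∈ z.1 → ∀ x : N, x.1 ∈ f.1 → x.1 ∈ y.1

end SetPredicates

namespace IsFODefinable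

variable {N : Set ZFSet.{u}} {α : Type}

theorem mem (a b : α) : IsFODefinable setLanguage (fun v : α → N => (v a).1 ∈ (v b).1) :=
  ⟨FirstOrder.Language.Relations.formula₂ (L := setLanguage) MembershipRel.mem
    (FirstOrder.Language.Term.var a) (FirstOrder.Language.Term.var b), fun _ =>
    FirstOrder.Language.Formula.realize_rel₂⟩

theorem setDisjoint (a b : α) :
    IsFODefinable setLanguage (fun v : α → N => SetDisjoint (v a) (v b)) :=
  (ex ((mem none (some a)).and (mem none (some b)))).not

theorem setPartitionPair (z a b c d : α) : IsFODefinable setLanguage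
    (fun v : α → N => SetPartitionPair (v z) (v a) (v b) (v c) (v d)) :=
  (mem c z).and <| (mem d z).and <| .and
    (.all <| .imp (mem none (some z)) <| .all <| .imp (mem none (some none)) <|
      .or (mem none (some (some c))) (mem none (some (some d))))
    ((setDisjoint c a).and (setDisjoint d b))

theorem isSetInter (w y c d : α) :
    IsFODefinable setLanguage (fun v : α → N => IsSetInter (v w) (v y) (v c) (v d)) :=
  .all <| .iff (mem none (some w)) <|
    (mem none (some y)).and <| (mem none (some c)).and (mem none (some d))

theorem setHasEmptyPartition (n : ℕ) {α : Type} (z : α) (a b : ℕ → α) (y : α) :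
    IsFODefinable setLanguage (fun v : α → N =>
      SetHasEmptyPartition (v z) n (fun i => v (a i)) (fun i => v (b i)) (v y)) := by
  induction n generalizing α with
  | zero => exact .not (.ex (mem none (some y)))
  | succ n ih =>
    exact .ex <| .ex <| .ex <| .and (setPartitionPair _ _ _ (some (some none)) (some none)) <|
      .and (isSetInter none _ _ _) <|
      ih (some (some (some z))) (fun i => some (some (some (a i))))
        (fun i => some (some (some (b i)))) none

theorem setStep (z a b K K' : α) :
    IsFODefinable setLanguage (fun v : α → N => SetStep (v z) (v a) (v b) (v K) (v K')) :=
  .all <| .all <| .all <| .all <| .imp (mem (some (some (some none))) _) <|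
    .imp (setPartitionPair _ _ _ (some (some none)) (some none)) <|
    .imp (isSetInter none _ _ _) (mem none _)

theorem setSuccessor (z T K a b K' : α) : IsFODefinable setLanguage
    (fun v : α → N => SetSuccessor (v z) (v T) (v K) (v a) (v b) (v K')) :=
  (mem a z).and <| (mem b z).and <| (setDisjoint a b).and <| (mem K' T).and (setStep z a b K K')

theorem isEssentialTree (z T : α) :
    IsFODefinable setLanguage (fun v : α → N => IsEssentialTree (v z) (v T)) :=
  .all <| .imp (mem none _) <| .and
    (.all <| .imp (mem none _) <| .ex <| mem none _)
    (.ex <| .ex <| .ex <| setSuccessor _ _ _ (some (some none)) (some none) none)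

theorem containsTop (z K : α) :
    IsFODefinable setLanguage (fun v : α → N => ContainsTop (v z) (v K)) :=
  .ex <| (mem none _).and <| (mem none _).and <| .all <| .imp (mem none _) <| .all <|
    .imp (mem none _) (mem none _)

end IsFODefinable

/-! ### The closed sets of a space that belong to a class -/

/-- `M` contains the bounds of the lattice of closed subsets of `X` and is closed under its
operations. -/
class IsClosedUnderLatticeOps (X : ZFSet.{u}) [TopologicalSpace X] (M : Set ZFSet.{u}) : Prop where
  empty_mem : ∅ ∈ M
  self_mem : X ∈ M
  union_mem : ∀ a ∈ closedSubsets X, ∀ b ∈ closedSubsets X, a ∈ M → b ∈ M → a ∪ b ∈ M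
  inter_mem : ∀ a ∈ closedSubsets X, ∀ b ∈ closedSubsets X, a ∈ M → b ∈ M → a ∩ b ∈ M

/-- The part `2^X ∩ M` of the lattice of closed subsets of `X` that lies in `M`. -/
abbrev ClosedSubsetsIn (X : ZFSet.{u}) [TopologicalSpace X] (M : Set ZFSet.{u}) : Type (u + 1) :=
  {F : ZFSet.{u} // F ∈ closedSubsets X ∧ F ∈ M}

section ClosedSubsets

variable {X : ZFSet.{u}} [TopologicalSpace X]

theorem mem_closedSubsets {F : ZFSet.{u}} :
    F ∈ closedSubsets X ↔ F ⊆ X ∧ IsClosed {x : X | (x : ZFSet.{u}) ∈ F} := by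
  rw [closedSubsets, ZFSet.mem_sep, ZFSet.mem_powerset]

theorem subset_of_mem_closedSubsets {F : ZFSet.{u}} (hF : F ∈ closedSubsets X) : F ⊆ X :=
  (mem_closedSubsets.1 hF).1

theorem empty_mem_closedSubsets : ∅ ∈ closedSubsets X :=
  mem_closedSubsets.2 ⟨ZFSet.empty_subset X, by simp⟩

theorem self_mem_closedSubsets : X ∈ closedSubsets X :=
  mem_closedSubsets.2 ⟨fun _ h => h, by simp⟩

theorem union_mem_closedSubsets {a b : ZFSet.{u}} (ha : a ∈ closedSubsets X)
    (hb : b ∈ closedSubsets X) : a ∪ b ∈ closedSubsets X := by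
  rw [mem_closedSubsets] at *
  refine ⟨fun x hx => (ZFSet.mem_union.1 hx).elim (fun h => ha.1 h) (fun h => hb.1 h), ?_⟩
  simp only [ZFSet.mem_union]
  exact ha.2.union hb.2

theorem inter_mem_closedSubsets {a b : ZFSet.{u}} (ha : a ∈ closedSubsets X)
    (hb : b ∈ closedSubsets X) : a ∩ b ∈ closedSubsets X := by
  rw [mem_closedSubsets] at *
  refine ⟨fun x hx => ha.1 (ZFSet.mem_inter.1 hx).1, ?_⟩
  simp only [ZFSet.mem_inter]
  exact ha.2.inter hb.2

instance : IsClosedUnderLatticeOps X Set.univ := by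
  constructor <;> simp

namespace ClosedSubsetsIn

variable {M : Set ZFSet.{u}}

theorem mem_space {a : ClosedSubsetsIn X M} {x : ZFSet.{u}} (hx : x ∈ a.1) : x ∈ X :=
  subset_of_mem_closedSubsets a.2.1 hx

variable [hM : IsClosedUnderLatticeOps X M]

/-- The lattice operations of `2^X ∩ M`, extending the order by inclusion. -/
noncomputable instance : DistribLattice (ClosedSubsetsIn X M) where
  sup a b := ⟨a.1 ∪ b.1, union_mem_closedSubsets a.2.1 b.2.1,
    hM.union_mem _ a.2.1 _ b.2.1 a.2.2 b.2.2⟩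
  inf a b := ⟨a.1 ∩ b.1, inter_mem_closedSubsets a.2.1 b.2.1,
    hM.inter_mem _ a.2.1 _ b.2.1 a.2.2 b.2.2⟩
  le_sup_left a b := show a.1 ⊆ a.1 ∪ b.1 from fun x hx => ZFSet.mem_union.2 (Or.inl hx)
  le_sup_right a b := show b.1 ⊆ a.1 ∪ b.1 from fun x hx => ZFSet.mem_union.2 (Or.inr hx)
  sup_le a b c h h' := show a.1 ∪ b.1 ⊆ c.1 from fun x hx =>
    (ZFSet.mem_union.1 hx).elim (fun hx => h hx) (fun hx => h' hx)
  inf_le_left a b := show a.1 ∩ b.1 ⊆ a.1 from fun x hx => (ZFSet.mem_inter.1 hx).1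
  inf_le_right a b := show a.1 ∩ b.1 ⊆ b.1 from fun x hx => (ZFSet.mem_inter.1 hx).2
  le_inf a b c h h' := show a.1 ⊆ b.1 ∩ c.1 from fun x hx => ZFSet.mem_inter.2 ⟨h hx, h' hx⟩
  le_sup_inf a b c := show (a.1 ∪ b.1) ∩ (a.1 ∪ c.1) ⊆ a.1 ∪ (b.1 ∩ c.1) from fun x hx => by
    simp only [ZFSet.mem_inter, ZFSet.mem_union] at *
    tauto

noncomputable instance : BoundedOrder (ClosedSubsetsIn X M) where
  top := ⟨X, self_mem_closedSubsets, hM.self_mem⟩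
  bot := ⟨∅, empty_mem_closedSubsets, hM.empty_mem⟩
  le_top a := show a.1 ⊆ X from subset_of_mem_closedSubsets a.2.1
  bot_le a := show ∅ ⊆ a.1 from ZFSet.empty_subset _

variable {a b c d : ClosedSubsetsIn X M} {x : ZFSet.{u}}

theorem mem_sup : x ∈ (a ⊔ b).1 ↔ x ∈ a.1 ∨ x ∈ b.1 := ZFSet.mem_union

theorem mem_inf : x ∈ (a ⊓ b).1 ↔ x ∈ a.1 ∧ x ∈ b.1 := ZFSet.mem_inter

theorem notMem_bot : x ∉ (⊥ : ClosedSubsetsIn X M).1 := ZFSet.notMem_empty x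

theorem eq_bot_iff_forall_notMem : a = ⊥ ↔ ∀ x, x ∉ a.1 :=
  Subtype.ext_iff.trans (ZFSet.eq_empty _)

theorem eq_top_iff_forall_mem : a = ⊤ ↔ ∀ x ∈ X, x ∈ a.1 :=
  ⟨fun h _ hx => h ▸ hx, fun h => Subtype.ext (ZFSet.ext fun x => ⟨mem_space, h x⟩)⟩

variable (X) in
theorem isClosedBase_univ :
    IsClosedBase (fun a : ClosedSubsetsIn X Set.univ => {x : X | (x : ZFSet.{u}) ∈ a.1}) where
  isClosed a := (mem_closedSubsets.1 a.2.1).2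
  map_inf a b := Set.ext fun x => mem_inf
  map_sup a b := Set.ext fun x => mem_sup
  map_bot := Set.eq_empty_of_forall_notMem fun _ => notMem_bot
  map_top := Set.eq_univ_of_forall Subtype.property
  le_of_subset a b h := show a.1 ⊆ b.1 from fun x hx => h (a := ⟨x, mem_space hx⟩) hx
  interpolate A O hA hO hAO := by
    have key : {x : X | (x : ZFSet.{u}) ∈ ZFSet.sep (fun x => ∃ h : x ∈ X, (⟨x, h⟩ : X) ∈ A) X} =
        A := by
      ext x
      simp
    refine ⟨⟨ZFSet.sep (fun x => ∃ h : x ∈ X, (⟨x, h⟩ : X) ∈ A) X, mem_closedSubsets.2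
      ⟨ZFSet.sep_subset, ?_⟩, trivial⟩, ?_⟩
    · rwa [key]
    · simp only [key]
      exact ⟨subset_rfl, hAO⟩

end ClosedSubsetsIn

end ClosedSubsets

/-! ### Comparing the closed sets with a transitive structure -/

namespace ClosedSubsetsIn

section Model

variable {X : ZFSet.{u}} [TopologicalSpace X] {N : Set ZFSet.{u}} {z : N}

/-- A member of `2^X ∩ M` as an element of a transitive structure `N` that contains `2^X`. -/
def toModel (hN : ∀ y ∈ N, ∀ x ∈ y, x ∈ N) (hz : z.1 = closedSubsets X) {M : Set ZFSet.{u}}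
    (a : ClosedSubsetsIn X M) : N :=
  ⟨a.1, hN _ z.2 _ (by rw [hz]; exact a.2.1)⟩

variable (hN : ∀ y ∈ N, ∀ x ∈ y, x ∈ N) (hz : z.1 = closedSubsets X)

theorem toModel_mem {M : Set ZFSet.{u}} (a : ClosedSubsetsIn X M) : (toModel hN hz a).1 ∈ z.1 := by
  rw [hz]
  exact a.2.1

theorem exists_toModel_eq {f : N} (hf : f.1 ∈ z.1) :
    ∃ a : ClosedSubsetsIn X Set.univ, toModel hN hz a = f :=
  ⟨⟨f.1, hz ▸ hf, trivial⟩, rfl⟩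

variable {M : Set ZFSet.{u}} [hM : IsClosedUnderLatticeOps X M] {a b c d y : ClosedSubsetsIn X M}

theorem eq_bot_iff_toModel : a = ⊥ ↔ ¬ ∃ x : N, x.1 ∈ (toModel hN hz a).1 := by
  rw [eq_bot_iff_forall_notMem, not_exists]
  exact ⟨fun h x => h x, fun h x hx => h ⟨x, hN _ (toModel hN hz a).2 _ hx⟩ hx⟩

theorem setDisjoint_toModel : SetDisjoint (toModel hN hz a) (toModel hN hz b) ↔ a ⊓ b = ⊥ := by
  rw [eq_bot_iff_toModel hN hz, SetDisjoint]
  exact not_congr (exists_congr fun x => mem_inf.symm)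

theorem setPartitionPair_toModel :
    SetPartitionPair z (toModel hN hz a) (toModel hN hz b) (toModel hN hz c) (toModel hN hz d) ↔
      IsPartitionPair a b c d := by
  rw [SetPartitionPair, IsPartitionPair, setDisjoint_toModel, setDisjoint_toModel,
    eq_top_iff_forall_mem]
  constructor
  · rintro ⟨-, -, h, h'⟩
    refine ⟨fun x hx => mem_sup.2 ?_, h'⟩
    let t : N := toModel hN hz (⊤ : ClosedSubsetsIn X M)
    exact h t (toModel_mem hN hz _) ⟨x, hN _ t.2 _ hx⟩ hx
  · rintro ⟨h, h'⟩
    exact ⟨toModel_mem hN hz _, toModel_mem hN hz _, fun f hf x hx =>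
      mem_sup.1 (h x (subset_of_mem_closedSubsets (hz ▸ hf) hx)), h'⟩

theorem isSetInter_toModel {w : N} :
    IsSetInter w (toModel hN hz y) (toModel hN hz c) (toModel hN hz d) ↔
      w = toModel hN hz (y ⊓ (c ⊓ d)) := by
  have key : ∀ x, x ∈ (y ⊓ (c ⊓ d)).1 ↔ x ∈ y.1 ∧ x ∈ c.1 ∧ x ∈ d.1 := fun x => by
    rw [mem_inf, mem_inf]
  constructor
  · refine fun h => Subtype.ext (ZFSet.ext fun x => ⟨fun hx => ?_, fun hx => ?_⟩)
    · exact (key x).2 ((h ⟨x, hN _ w.2 _ hx⟩).1 hx)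
    · exact (h ⟨x, hN _ (toModel hN hz _).2 _ hx⟩).2 ((key x).1 hx)
  · rintro rfl x
    exact key x

theorem setHasEmptyPartition_toModel {n : ℕ} {a b : ℕ → ClosedSubsetsIn X M}
    (h : HasEmptyPartition n a b y) : SetHasEmptyPartition z n (fun i => toModel hN hz (a i))
      (fun i => toModel hN hz (b i)) (toModel hN hz y) := by
  induction n generalizing y with
  | zero => exact (eq_bot_iff_toModel hN hz).1 h
  | succ n ih =>
    obtain ⟨c, d, h1, h2⟩ := h
    exact ⟨_, _, _, (setPartitionPair_toModel hN hz).2 h1, (isSetInter_toModel hN hz).2 rfl, ih h2⟩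

end Model

/-! ### Reflection to an elementary submodel -/

section Submodel

variable {X : ZFSet.{u}} [TopologicalSpace X] {N : Set ZFSet.{u}} {z : N}
  {S : setLanguage.ElementarySubstructure N}

theorem isClosedUnderLatticeOps (hN : ∀ y ∈ N, ∀ x ∈ y, x ∈ N) (hz : z.1 = closedSubsets X)
    (hzS : z ∈ S) : IsClosedUnderLatticeOps X (Subtype.val '' (S : Set N)) where
  empty_mem := by
    have h0 : ∅ ∈ z.1 := by
      rw [hz]
      exact empty_mem_closedSubsets
    obtain ⟨w, hw, h⟩ := IsFODefinable.exists_mem (α := Unit)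
      (R := fun _ w => ¬ ∃ x : N, x.1 ∈ w.1) (.not (.ex (.mem none _))) S (v := fun _ => z)
      (fun _ => hzS) ⟨⟨∅, hN _ z.2 _ h0⟩, by simp⟩
    exact ⟨w, hw, (ZFSet.eq_empty _).2 fun x hx => h ⟨⟨x, hN _ w.2 _ hx⟩, hx⟩⟩
  self_mem := by
    have hX : X ∈ z.1 := by
      rw [hz]
      exact self_mem_closedSubsets
    obtain ⟨w, hw, h1, h2⟩ := IsFODefinable.exists_mem (α := Unit)
      (R := fun v w => w.1 ∈ (v ()).1 ∧ ∀ f : N, f.1 ∈ (v ()).1 → ∀ x : N, x.1 ∈ f.1 → x.1 ∈ w.1)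
      ((IsFODefinable.mem none _).and (.all (.imp (.mem none _) (.all (.imp (.mem none _)
        (.mem none _)))))) S (v := fun _ => z) (fun _ => hzS)
      ⟨⟨X, hN _ z.2 _ hX⟩, hX, fun f hf x hx => subset_of_mem_closedSubsets (hz ▸ hf) hx⟩
    refine ⟨w, hw, ZFSet.ext fun x =>
      ⟨fun hx => subset_of_mem_closedSubsets (hz ▸ h1) hx, fun hx => ?_⟩⟩
    exact h2 ⟨X, hN _ z.2 _ hX⟩ hX ⟨x, hN _ (hN _ z.2 _ hX) _ hx⟩ hx
  union_mem := by
    rintro _ ha _ hb ⟨a, haS, rfl⟩ ⟨b, hbS, rfl⟩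
    obtain ⟨w, hw, h⟩ := IsFODefinable.exists_mem (α := Bool)
      (R := fun v w => ∀ x : N, x.1 ∈ w.1 ↔ x.1 ∈ (v true).1 ∨ x.1 ∈ (v false).1)
      (.all (.iff (.mem none _) (.or (.mem none _) (.mem none _)))) S
      (v := fun i => if i then a else b) (by rintro (_ | _) <;> simpa)
      ⟨⟨a.1 ∪ b.1, hN _ z.2 _ (hz ▸ union_mem_closedSubsets ha hb)⟩, fun x => ZFSet.mem_union⟩
    refine ⟨w, hw, ZFSet.ext fun x => ?_⟩
    rw [ZFSet.mem_union]
    exact ⟨fun hx => (h ⟨x, hN _ w.2 _ hx⟩).1 hx, fun hx =>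
      (h ⟨x, hx.elim (hN _ a.2 _) (hN _ b.2 _)⟩).2 hx⟩
  inter_mem := by
    rintro _ ha _ hb ⟨a, haS, rfl⟩ ⟨b, hbS, rfl⟩
    obtain ⟨w, hw, h⟩ := IsFODefinable.exists_mem (α := Bool)
      (R := fun v w => ∀ x : N, x.1 ∈ w.1 ↔ x.1 ∈ (v true).1 ∧ x.1 ∈ (v false).1)
      (.all (.iff (.mem none _) (.and (.mem none _) (.mem none _)))) S
      (v := fun i => if i then a else b) (by rintro (_ | _) <;> simpa)
      ⟨⟨a.1 ∩ b.1, hN _ z.2 _ (hz ▸ inter_mem_closedSubsets ha hb)⟩, fun x => ZFSet.mem_inter⟩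
    refine ⟨w, hw, ZFSet.ext fun x => ?_⟩
    rw [ZFSet.mem_inter]
    exact ⟨fun hx => (h ⟨x, hN _ w.2 _ hx⟩).1 hx, fun hx => (h ⟨x, hN _ a.2 _ hx.1⟩).2 hx⟩

variable (hN : ∀ y ∈ N, ∀ x ∈ y, x ∈ N) (hz : z.1 = closedSubsets X)

theorem toModel_mem_submodel (a : ClosedSubsetsIn X (Subtype.val '' (S : Set N))) :
    toModel hN hz a ∈ S := by
  obtain ⟨_, _, x, hx, rfl⟩ := a
  exact hx

theorem exists_toModel_eq_of_mem {f : N} (hfS : f ∈ S) (hf : f.1 ∈ z.1) :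
    ∃ a : ClosedSubsetsIn X (Subtype.val '' (S : Set N)), toModel hN hz a = f :=
  ⟨⟨f.1, hz ▸ hf, f, hfS, rfl⟩, rfl⟩

variable [hM : IsClosedUnderLatticeOps X (Subtype.val '' (S : Set N))]

theorem hasEmptyPartition_of_setHasEmptyPartition (hzS : z ∈ S) {n : ℕ}
    {a b : ℕ → ClosedSubsetsIn X (Subtype.val '' (S : Set N))}
    {y : ClosedSubsetsIn X (Subtype.val '' (S : Set N))}
    (h : SetHasEmptyPartition z n (fun i => toModel hN hz (a i)) (fun i => toModel hN hz (b i))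
      (toModel hN hz y)) : HasEmptyPartition n a b y := by
  induction n generalizing y with
  | zero => exact (eq_bot_iff_toModel hN hz).2 h
  | succ n ih =>
    -- The variables are `z`, then the terms of the two sequences, then `y`, `c`, `d`.
    let v : Option (Option (ℕ ⊕ ℕ)) → N := fun o => o.elim (toModel hN hz y) fun o => o.elim z
      (Sum.elim (fun i => toModel hN hz (a i)) (fun i => toModel hN hz (b i)))
    have hv : ∀ i, v i ∈ S := by
      rintro (_ | _ | _ | _) <;> first | exact hzS | exact toModel_mem_submodel hN hz _
    obtain ⟨c, hcS, hc⟩ := IsFODefinable.exists_mem (α := Option (Option (ℕ ⊕ ℕ)))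
      (R := fun v c => ∃ d w : N,
        SetPartitionPair (v (some none)) (v (some (some (Sum.inl n)))) (v (some (some (Sum.inr n))))
          c d ∧ IsSetInter w (v none) c d ∧
        SetHasEmptyPartition (v (some none)) n (fun i => v (some (some (Sum.inl i))))
          (fun i => v (some (some (Sum.inr i)))) w)
      (.ex <| .ex <| .and (.setPartitionPair _ _ _ (some (some none)) (some none)) <|
        .and (.isSetInter none _ _ (some none)) <| .setHasEmptyPartition n _ _ _ none) S hv h
    obtain ⟨d, hdS, w, h1, h2, h3⟩ := IsFODefinable.exists_mem
      (α := Option (Option (Option (ℕ ⊕ ℕ))))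
      (R := fun v d => ∃ w : N,
        SetPartitionPair (v (some (some none))) (v (some (some (some (Sum.inl n)))))
          (v (some (some (some (Sum.inr n))))) (v none) d ∧ IsSetInter w (v (some none)) (v none) d ∧
        SetHasEmptyPartition (v (some (some none))) n (fun i => v (some (some (some (Sum.inl i)))))
          (fun i => v (some (some (some (Sum.inr i))))) w)
      (.ex <| .and (.setPartitionPair _ _ _ (some (some none)) (some none)) <|
        .and (.isSetInter none _ _ (some none)) <| .setHasEmptyPartition n _ _ _ none) S
      (v := fun o => o.elim c v) (by rintro (_ | i); exacts [hcS, hv i]) hc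
    obtain ⟨c, rfl⟩ := exists_toModel_eq_of_mem hN hz hcS h1.1
    obtain ⟨d, rfl⟩ := exists_toModel_eq_of_mem hN hz hdS h1.2.1
    obtain rfl := (isSetInter_toModel hN hz).1 h2
    exact ⟨c, d, (setPartitionPair_toModel hN hz).1 h1, ih h3⟩

/-- Partitions with empty intersection that exist in the lattice of all closed sets can be found in
the submodel. -/
theorem hasEmptyPartition_of_univ (hN : ∀ y ∈ N, ∀ x ∈ y, x ∈ N) (hz : z.1 = closedSubsets X)
    (hzS : z ∈ S) {n : ℕ} {a b : ℕ → ClosedSubsetsIn X (Subtype.val '' (S : Set N))}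
    {y : ClosedSubsetsIn X (Subtype.val '' (S : Set N))}
    (h : HasEmptyPartition (L := ClosedSubsetsIn X Set.univ) n
      (fun i => ⟨(a i).1, (a i).2.1, trivial⟩) (fun i => ⟨(b i).1, (b i).2.1, trivial⟩)
      ⟨y.1, y.2.1, trivial⟩) :
    HasEmptyPartition n a b y :=
  have h' := setHasEmptyPartition_toModel hN hz h
  hasEmptyPartition_of_setHasEmptyPartition hN hz hzS h'

end Submodel

end ClosedSubsetsIn

namespace ClosedSubsetsIn

section Submodel

variable {X : ZFSet.{u}} [TopologicalSpace X] {N : Set ZFSet.{u}}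
  {z : N} {S : setLanguage.ElementarySubstructure N}
  [hM : IsClosedUnderLatticeOps X (Subtype.val '' (S : Set N))]

theorem isNormalLattice [NormalSpace X] (hN : ∀ y ∈ N, ∀ x ∈ y, x ∈ N)
    (hz : z.1 = closedSubsets X) (hzS : z ∈ S) :
    IsNormalLattice (ClosedSubsetsIn X (Subtype.val '' (S : Set N))) := by
  intro a b hab
  have hab' := congrArg Subtype.val hab
  obtain ⟨c, d, hcd⟩ := (isClosedBase_univ X).isNormalLattice ⟨a.1, a.2.1, trivial⟩
    ⟨b.1, b.2.1, trivial⟩ (Subtype.ext hab')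
  obtain ⟨c, d, hcd, -⟩ := hasEmptyPartition_of_univ hN hz hzS (n := 1) (a := fun _ => a)
    (b := fun _ => b) (y := ⊥) ⟨c, d, hcd, bot_inf_eq (c ⊓ d)⟩
  exact ⟨c, d, hcd⟩

theorem isSeparativeLattice [T1Space X] (hN : ∀ y ∈ N, ∀ x ∈ y, x ∈ N)
    (hz : z.1 = closedSubsets X) (hzS : z ∈ S) :
    IsSeparativeLattice (ClosedSubsetsIn X (Subtype.val '' (S : Set N))) := by
  intro a b hab
  obtain ⟨c, h1, h2, h3⟩ := (isClosedBase_univ X).isSeparativeLattice ⟨a.1, a.2.1, trivial⟩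
    ⟨b.1, b.2.1, trivial⟩ hab
  obtain ⟨c, hcS, h0, h1, h2, h3⟩ := IsFODefinable.exists_mem (α := Option Bool)
    (R := fun v c => c.1 ∈ (v none).1 ∧ (¬ ¬ ∃ x : N, x.1 ∈ c.1) ∧
      (∀ x : N, x.1 ∈ c.1 → x.1 ∈ (v (some true)).1) ∧ SetDisjoint c (v (some false)))
    (.and (.mem none _) <| .and (.not (.not (.ex (.mem none _)))) <|
      .and (.all (.imp (.mem none _) (.mem none _))) (.setDisjoint none _))
    S (v := fun o => o.elim z fun i => if i then toModel hN hz a else toModel hN hz b)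
    (by
      rintro (_ | _ | _)
      exacts [hzS, toModel_mem_submodel hN hz _, toModel_mem_submodel hN hz _])
    ⟨toModel hN hz c, toModel_mem hN hz c, (eq_bot_iff_toModel hN hz).not.1 h1, fun x hx => h2 hx,
      (setDisjoint_toModel hN hz).2 h3⟩
  obtain ⟨c, rfl⟩ := exists_toModel_eq_of_mem hN hz hcS h0
  exact ⟨c, (eq_bot_iff_toModel hN hz).not.2 h1,
    show c.1 ⊆ a.1 from fun x hx => h2 ⟨x, hN _ (toModel hN hz c).2 _ hx⟩ hx,
    (setDisjoint_toModel hN hz).1 h3⟩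

/-- An essential tree in the submodel produces, by dependent choice outside of the submodel, a
sequence of pairs in the submodel that witnesses strong infinite dimension. -/
theorem exists_seq_of_isEssentialTree (hN : ∀ y ∈ N, ∀ x ∈ y, x ∈ N) (hz : z.1 = closedSubsets X)
    (hzS : z ∈ S) (hT : ∃ T : N, IsEssentialTree z T ∧ ∃ K : N, K.1 ∈ T.1 ∧ ContainsTop z K) :
    ∃ a b : ℕ → ClosedSubsetsIn X (Subtype.val '' (S : Set N)), (∀ i, a i ⊓ b i = ⊥) ∧
      ∀ n, ¬ HasEmptyPartition n a b ⊤ := by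
  obtain ⟨T, hTS, hT, hK⟩ := IsFODefinable.exists_mem (α := Unit)
    (R := fun v T => IsEssentialTree (v ()) T ∧ ∃ K : N, K.1 ∈ T.1 ∧ ContainsTop (v ()) K)
    (.and (.isEssentialTree _ none) (.ex (.and (.mem none (some none)) (.containsTop _ none))))
    S (v := fun _ => z) (fun _ => hzS) hT
  obtain ⟨K₀, hK₀S, hK₀T, hK₀⟩ := IsFODefinable.exists_mem (α := Bool)
    (R := fun v K => K.1 ∈ (v true).1 ∧ ContainsTop (v false) K)
    (.and (.mem none _) (.containsTop _ none)) S (v := fun i => if i then T else z)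
    (by rintro (_ | _) <;> simpa) hK
  have hsucc : ∀ K : {K : N // K ∈ S ∧ K.1 ∈ T.1}, ∃ a b : N, ∃ K' : {K : N // K ∈ S ∧ K.1 ∈ T.1},
      a ∈ S ∧ b ∈ S ∧ SetSuccessor z T K.1 a b K'.1 := by
    rintro ⟨K, hKS, hKT⟩
    let v : Fin 3 → N := ![z, T, K]
    have hv : ∀ i, v i ∈ S := by
      intro i
      fin_cases i
      exacts [hzS, hTS, hKS]
    obtain ⟨a, haS, ha⟩ := IsFODefinable.exists_mem (α := Fin 3)
      (R := fun v a => ∃ b K' : N, SetSuccessor (v 0) (v 1) (v 2) a b K')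
      (.ex (.ex (.setSuccessor _ _ _ (some (some none)) (some none) none))) S hv (hT K hKT).2
    obtain ⟨b, hbS, hb⟩ := IsFODefinable.exists_mem (α := Option (Fin 3))
      (R := fun v b => ∃ K' : N, SetSuccessor (v (some 0)) (v (some 1)) (v (some 2)) (v none) b K')
      (.ex (.setSuccessor _ _ _ _ (some none) none)) S (v := fun o => o.elim a v)
      (by rintro (_ | i); exacts [haS, hv i]) ha
    obtain ⟨K', hKS', hK'⟩ := IsFODefinable.exists_mem (α := Option (Option (Fin 3)))
      (R := fun v K' => SetSuccessor (v (some (some 0))) (v (some (some 1))) (v (some (some 2)))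
        (v (some none)) (v none) K')
      (.setSuccessor _ _ _ _ _ none) S (v := fun o => o.elim b fun o => o.elim a v)
      (by rintro (_ | _ | i); exacts [hbS, haS, hv i]) hb
    exact ⟨a, b, ⟨K', hKS', hK'.2.2.2.1⟩, haS, hbS, hK'⟩
  choose a b next haS hbS hnext using hsucc
  choose a' ha' using fun K => exists_toModel_eq_of_mem hN hz (haS K) (hnext K).1
  choose b' hb' using fun K => exists_toModel_eq_of_mem hN hz (hbS K) (hnext K).2.1
  let K : ℕ → {K : N // K ∈ S ∧ K.1 ∈ T.1} := fun n => next^[n] ⟨K₀, hK₀S, hK₀T⟩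
  have hKsucc : ∀ n, K (n + 1) = next (K n) := fun n => Function.iterate_succ_apply' _ _ _
  refine ⟨fun n => a' (K n), fun n => b' (K n), fun n => ?_, fun n hn => ?_⟩
  · rw [← setDisjoint_toModel hN hz, ha', hb']
    exact (hnext (K n)).2.2.1
  obtain ⟨c, d, hcd, h0⟩ := hasEmptyPartition_iff.1 hn
  have key : ∀ k ≤ n, (toModel hN hz ((Finset.range k).inf fun i => c i ⊓ d i)).1 ∈ (K k).1.1 := by
    intro k hk
    induction k with
    | zero =>
      obtain ⟨y, hyK, hyz, hy⟩ := hK₀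
      have : y = toModel hN hz (⊤ : ClosedSubsetsIn X (Subtype.val '' (S : Set N))) := by
        refine Subtype.ext (ZFSet.ext fun x =>
          ⟨fun hx => subset_of_mem_closedSubsets (X := X) (hz ▸ hyz) hx, fun hx => ?_⟩)
        let t : N := toModel hN hz (⊤ : ClosedSubsetsIn X (Subtype.val '' (S : Set N)))
        exact hy t (toModel_mem hN hz _) ⟨x, hN _ t.2 _ hx⟩ hx
      rwa [Finset.range_zero, Finset.inf_empty, ← this]
    | succ k ih =>
      rw [Finset.range_add_one, Finset.inf_insert, inf_comm, hKsucc]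
      refine (hnext (K k)).2.2.2.2 _ _ _ _ (ih (by omega)) ?_ ((isSetInter_toModel hN hz).2 rfl)
      rw [← ha', ← hb']
      exact (setPartitionPair_toModel hN hz).2 (hcd k (by omega))
  rw [top_inf_eq] at h0
  exact (eq_bot_iff_toModel hN hz).1 h0 ((hT _ (K n).2.2).1 _ (key n le_rfl))

end Submodel

/-! ### Essential trees from strong infinite dimension -/

section Tree

variable {X : ZFSet.{u}} [TopologicalSpace X] (a b : ℕ → ClosedSubsetsIn X Set.univ)

/-- The family of all intersections of `n` partitions, one between `a i` and `b i` for each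
`i < n`. -/
noncomputable def partitionFamily (n : ℕ) : ZFSet.{u} :=
  ZFSet.sep (fun F => ∃ c d : ℕ → ClosedSubsetsIn X Set.univ,
    (∀ i < n, IsPartitionPair (a i) (b i) (c i) (d i)) ∧
      F = ((Finset.range n).inf fun i => c i ⊓ d i).1) (closedSubsets X)

/-- The set of the families `partitionFamily a b n`. -/
noncomputable def partitionTree : ZFSet.{u} :=
  ZFSet.sep (fun K => ∃ n, K = partitionFamily a b n) (closedSubsets X).powerset

variable {a b}

theorem mem_partitionFamily {n : ℕ} {F : ZFSet.{u}} : F ∈ partitionFamily a b n ↔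
    ∃ c d : ℕ → ClosedSubsetsIn X Set.univ, (∀ i < n, IsPartitionPair (a i) (b i) (c i) (d i)) ∧
      F = ((Finset.range n).inf fun i => c i ⊓ d i).1 := by
  rw [partitionFamily, ZFSet.mem_sep]
  refine ⟨fun h => h.2, fun h => ⟨?_, h⟩⟩
  obtain ⟨c, d, -, rfl⟩ := h
  exact ((Finset.range n).inf fun i => c i ⊓ d i).2.1

theorem partitionFamily_subset {n : ℕ} : partitionFamily a b n ⊆ closedSubsets X :=
  ZFSet.sep_subset

theorem mem_partitionTree {K : ZFSet.{u}} :
    K ∈ partitionTree a b ↔ ∃ n, K = partitionFamily a b n := by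
  rw [partitionTree, ZFSet.mem_sep, ZFSet.mem_powerset]
  refine ⟨fun h => h.2, fun h => ⟨?_, h⟩⟩
  obtain ⟨n, rfl⟩ := h
  exact partitionFamily_subset

theorem isEssentialTree_partitionTree {N : Set ZFSet.{u}} {z : N} (hN : ∀ y ∈ N, ∀ x ∈ y, x ∈ N)
    (hz : z.1 = closedSubsets X) (hab : ∀ i, a i ⊓ b i = ⊥) (h : ∀ n, ¬ HasEmptyPartition n a b ⊤)
    (hT : partitionTree a b ∈ N) :
    IsEssentialTree z ⟨partitionTree a b, hT⟩ ∧
      ∃ K : N, K.1 ∈ partitionTree a b ∧ ContainsTop z K := by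
  have hKN : ∀ n, partitionFamily a b n ∈ N := fun n => hN _ hT _ (mem_partitionTree.2 ⟨n, rfl⟩)
  constructor
  · rintro ⟨K, hK⟩ hKT
    obtain ⟨n, rfl⟩ := mem_partitionTree.1 hKT
    constructor
    · rintro ⟨w, hwN⟩ hw
      obtain ⟨c, d, hcd, rfl⟩ := mem_partitionFamily.1 hw
      by_contra hne
      refine h n (hasEmptyPartition_iff.2 ⟨c, d, hcd, ?_⟩)
      rw [top_inf_eq]
      exact (eq_bot_iff_toModel hN hz).2 hne
    · refine ⟨toModel hN hz (a n), toModel hN hz (b n), ⟨partitionFamily a b (n + 1), hKN _⟩,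
        toModel_mem hN hz _, toModel_mem hN hz _, (setDisjoint_toModel hN hz).2 (hab n),
        mem_partitionTree.2 ⟨_, rfl⟩, ?_⟩
      intro y c d w hy hcd hw
      obtain ⟨y, rfl⟩ := exists_toModel_eq hN hz (hz ▸ partitionFamily_subset hy)
      obtain ⟨c, rfl⟩ := exists_toModel_eq hN hz hcd.1
      obtain ⟨d, rfl⟩ := exists_toModel_eq hN hz hcd.2.1
      obtain rfl := (isSetInter_toModel hN hz).1 hw
      have hcd := (setPartitionPair_toModel hN hz).1 hcd
      obtain ⟨c', d', hcd', hy⟩ := mem_partitionFamily.1 hy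
      obtain rfl : y = _ := Subtype.ext hy
      refine mem_partitionFamily.2 ⟨fun i => if i < n then c' i else c,
        fun i => if i < n then d' i else d, fun i hi => ?_, ?_⟩
      · by_cases hin : i < n
        · simpa [hin] using hcd' i hin
        · obtain rfl : i = n := by omega
          simpa using hcd
      · rw [Finset.range_add_one, Finset.inf_insert, inf_comm]
        simp only [lt_irrefl, if_false]
        refine congrArg Subtype.val (congrArg (c ⊓ d ⊓ ·) (Finset.inf_congr rfl fun i hi => ?_))
        simp [Finset.mem_range.1 hi]
  · refine ⟨⟨partitionFamily a b 0, hKN 0⟩, mem_partitionTree.2 ⟨0, rfl⟩,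
      toModel hN hz (⊤ : ClosedSubsetsIn X Set.univ), mem_partitionFamily.2 ⟨a, b, by simp, ?_⟩,
      toModel_mem hN hz _, fun f hf x hx =>
        subset_of_mem_closedSubsets (X := X) (hz ▸ hf) hx⟩
    rw [Finset.range_zero, Finset.inf_empty]
    rfl

theorem transitiveClosure_partitionTree_subset :
    transitiveClosure (partitionTree a b) ⊆ transitiveClosure X.powerset.powerset := by
  intro y hy
  obtain ⟨K, hyK, hK⟩ := Relation.TransGen.tail'_iff.1 hy
  refine Relation.TransGen.tail'_iff.2 ⟨K, hyK, ZFSet.mem_powerset.2 fun F hF => ?_⟩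
  obtain ⟨n, rfl⟩ := mem_partitionTree.1 hK
  exact ZFSet.mem_powerset.2 (subset_of_mem_closedSubsets (partitionFamily_subset hF))

end Tree

end ClosedSubsetsIn

/-! ### Reflection of weak and strong infinite dimension by submodels -/

theorem hereditarySets_of_subset {κ : Cardinal.{u}} {x y : ZFSet.{u}} (hx : x ∈ hereditarySets κ)
    (h : transitiveClosure y ⊆ transitiveClosure x) : y ∈ hereditarySets κ :=
  (Cardinal.mk_le_mk_of_subset h).trans_lt hx

theorem mem_hereditarySets_of_mem {κ : Cardinal.{u}} :
    ∀ y ∈ hereditarySets κ, ∀ x ∈ y, x ∈ hereditarySets κ := fun _ hy _ hx =>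
  hereditarySets_of_subset hy fun _ hw => Relation.TransGen.tail hw hx

theorem elementarilyReflectedBySubmodels_stronglyInfiniteDimensional :
    ElementarilyReflectedBySubmodels.{u} (fun Y _ => StronglyInfiniteDimensional Y) := by
  rintro X _ _ _ hX κ _ - hκ ⟨S, rfl⟩ ⟨z, hzS, hz⟩ hw
  have hN := mem_hereditarySets_of_mem (κ := κ)
  have := ClosedSubsetsIn.isClosedUnderLatticeOps hN hz hzS
  rw [StronglyInfiniteDimensional,
    (ClosedSubsetsIn.isClosedBase_univ X).weaklyInfiniteDimensional_iff] at hX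
  push Not at hX
  obtain ⟨a, b, hab, h⟩ := hX
  obtain ⟨h1, h2⟩ := ClosedSubsetsIn.isEssentialTree_partitionTree hN hz hab h
    (hereditarySets_of_subset hκ ClosedSubsetsIn.transitiveClosure_partitionTree_subset)
  obtain ⟨a, b, hab, h⟩ := ClosedSubsetsIn.exists_seq_of_isEssentialTree hN hz hzS ⟨_, h1, h2⟩
  obtain ⟨n, hn⟩ := (WallmanSpace.weaklyInfiniteDimensional_iff
    (ClosedSubsetsIn.isNormalLattice hN hz hzS)
    (ClosedSubsetsIn.isSeparativeLattice hN hz hzS)).1 hw a b hab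
  exact h n hn

theorem elementarilyReflectedBySubmodels_weaklyInfiniteDimensional :
    ElementarilyReflectedBySubmodels.{u} (fun Y _ => WeaklyInfiniteDimensional Y) := by
  rintro X _ _ _ hX κ _ - - ⟨S, rfl⟩ ⟨z, hzS, hz⟩
  have hN := mem_hereditarySets_of_mem (κ := κ)
  have := ClosedSubsetsIn.isClosedUnderLatticeOps hN hz hzS
  refine (WallmanSpace.weaklyInfiniteDimensional_iff
    (ClosedSubsetsIn.isNormalLattice hN hz hzS)
    (ClosedSubsetsIn.isSeparativeLattice hN hz hzS)).2 fun a b hab => ?_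
  have hab' := fun i => congrArg Subtype.val (hab i)
  obtain ⟨n, hn⟩ := (ClosedSubsetsIn.isClosedBase_univ X).weaklyInfiniteDimensional_iff.1 hX
    (fun i => ⟨(a i).1, (a i).2.1, trivial⟩) (fun i => ⟨(b i).1, (b i).2.1, trivial⟩)
    (fun i => Subtype.ext (hab' i))
  exact ⟨n, ClosedSubsetsIn.hasEmptyPartition_of_univ hN hz hzS hn⟩

/-! ### Adding a zero-dimensional summand -/

section Sum

variable {X Y : Type*} [TopologicalSpace X] [TopologicalSpace Y]

theorem WeaklyInfiniteDimensional.sum (hX : WeaklyInfiniteDimensional X)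
    (hY : WeaklyInfiniteDimensional Y) : WeaklyInfiniteDimensional (X ⊕ Y) := by
  intro A B hA hB hAB
  obtain ⟨S, hS, hSe⟩ := hX (fun i => Sum.inl ⁻¹' A i) (fun i => Sum.inl ⁻¹' B i)
    (fun i => (hA i).preimage continuous_inl) (fun i => (hB i).preimage continuous_inl)
    (fun i => (hAB i).preimage _)
  obtain ⟨T, hT, hTe⟩ := hY (fun i => Sum.inr ⁻¹' A i) (fun i => Sum.inr ⁻¹' B i)
    (fun i => (hA i).preimage continuous_inr) (fun i => (hB i).preimage continuous_inr)
    (fun i => (hAB i).preimage _)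
  refine ⟨fun i => {p | Sum.elim (· ∈ S i) (· ∈ T i) p}, fun i => ?_, ?_⟩
  · obtain ⟨U, V, hU, hV, hAU, hBV, hUV, hSUV⟩ := hS i
    obtain ⟨U', V', hU', hV', hAU', hBV', hUV', hSUV'⟩ := hT i
    refine ⟨{p | Sum.elim (· ∈ U) (· ∈ U') p}, {p | Sum.elim (· ∈ V) (· ∈ V') p},
      isOpen_sum_iff.2 ⟨hU, hU'⟩, isOpen_sum_iff.2 ⟨hV, hV'⟩, ?_, ?_, ?_, ?_⟩
    · rintro (x | x) hx
      exacts [hAU hx, hAU' hx]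
    · rintro (x | x) hx
      exacts [hBV hx, hBV' hx]
    · rw [Set.disjoint_left]
      rintro (x | x) hx hx'
      exacts [hUV.le_bot ⟨hx, hx'⟩, hUV'.le_bot ⟨hx, hx'⟩]
    · ext (x | x)
      exacts [Set.ext_iff.1 hSUV x, Set.ext_iff.1 hSUV' x]
  · rw [Set.eq_empty_iff_forall_notMem]
    rintro (x | x) hx
    · exact Set.eq_empty_iff_forall_notMem.1 hSe x
        (Set.mem_iInter.2 fun i => Set.mem_iInter.1 hx i)
    · exact Set.eq_empty_iff_forall_notMem.1 hTe x
        (Set.mem_iInter.2 fun i => Set.mem_iInter.1 hx i)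

theorem PropertyC.of_sum (h : PropertyC (X ⊕ Y)) : PropertyC X := by
  intro 𝒰 hopen hcov
  obtain ⟨𝒱, h1, h2, h3, h4⟩ := h (fun i => insert (Set.range Sum.inr) ((Sum.inl '' ·) '' 𝒰 i))
    (by
      rintro i _ (rfl | ⟨U, hU, rfl⟩)
      exacts [isOpen_range_inr, isOpenMap_inl _ (hopen i U hU)])
    (by
      refine fun i => Set.eq_univ_of_forall ?_
      rintro (x | y)
      · obtain ⟨U, hU, hx⟩ := Set.eq_univ_iff_forall.1 (hcov i) x
        exact ⟨_, Or.inr ⟨U, hU, rfl⟩, x, hx, rfl⟩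
      · exact ⟨_, Or.inl rfl, y, rfl⟩)
  -- Only the members meeting `X` are kept: the others need not refine the given covers.
  refine ⟨fun i => {W | W.Nonempty ∧ ∃ V ∈ 𝒱 i, W = Sum.inl ⁻¹' V}, ?_, ?_, ?_, ?_⟩
  · rintro i _ ⟨-, V, hV, rfl⟩
    exact (h1 i V hV).preimage continuous_inl
  · rintro i _ ⟨-, V, hV, rfl⟩ _ ⟨-, W, hW, rfl⟩ hne
    exact (h2 i hV hW fun h => hne (by rw [h])).preimage _
  · rintro i _ ⟨⟨x, hx⟩, V, hV, rfl⟩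
    obtain ⟨_, rfl | ⟨U, hU, rfl⟩, hVU⟩ := h3 i V hV
    · obtain ⟨y, hy⟩ := hVU hx
      cases hy
    · refine ⟨U, hU, fun y hy => ?_⟩
      obtain ⟨y', hy', h⟩ := hVU hy
      exact Sum.inl_injective h ▸ hy'
  · refine Set.eq_univ_of_forall fun x => ?_
    obtain ⟨i, V, hV, hx⟩ := Set.mem_iUnion.1 (Set.eq_univ_iff_forall.1 h4 (Sum.inl x))
    exact Set.mem_iUnion.2 ⟨i, _, ⟨⟨x, hx⟩, V, hV, rfl⟩, hx⟩

theorem weaklyInfiniteDimensional_of_totallyDisconnected [CompactSpace X] [T2Space X]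
    [TotallyDisconnectedSpace X] : WeaklyInfiniteDimensional X := by
  intro A B hA hB hAB
  refine ⟨fun _ => ∅, fun i => ?_, Set.iInter_const _⟩
  obtain ⟨C, hC, hAC, hCB⟩ := exists_clopen_of_closed_subset_open (hA i) (hB i).isOpen_compl
    (Set.disjoint_left.1 (hAB i))
  exact ⟨C, Cᶜ, hC.isOpen, hC.isClosed.isOpen_compl, hAC, fun x hx hx' => hCB hx' hx,
    disjoint_compl_right, by simp⟩

/-- A second countable `T₀` space has at most continuum many points, so a larger power of the
two-point space is not metrizable. -/
theorem not_metrizableSpace_cube : ¬ MetrizableSpace (ULift.{u} ℝ → Bool) := by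
  intro h
  have hinj : Function.Injective (fun (x : ULift.{u} ℝ → Bool) =>
      {U : countableBasis (ULift.{u} ℝ → Bool) | x ∈ U.1}) := by
    intro x y hxy
    refine (isBasis_countableBasis _).inseparable_iff.2 (fun U hU => ?_) |>.eq
    exact Set.ext_iff.1 hxy ⟨U, hU⟩
  have h1 := Cardinal.mk_le_of_injective hinj
  have h2 : Cardinal.mk (countableBasis (ULift.{u} ℝ → Bool)) ≤ Cardinal.aleph0 :=
    Cardinal.mk_le_aleph0_iff.2 (countable_countableBasis _).to_subtype
  have h3 : Cardinal.mk (ULift.{u} ℝ → Bool) = 2 ^ Cardinal.continuum := by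
    simp [Cardinal.mk_real]
  rw [h3, Cardinal.mk_set] at h1
  have h4 := h1.trans (Cardinal.power_le_power_left two_ne_zero h2)
  rw [Cardinal.two_power_aleph0] at h4
  exact (Cardinal.cantor _).not_ge h4

end Sum

theorem exists_nonmetrizable_of_metrizable
    (h : ∃ (X : Type u) (_ : TopologicalSpace X), CompactSpace X ∧ MetrizableSpace X ∧
      WeaklyInfiniteDimensional X ∧ ¬ PropertyC X) :
    ∃ (X : Type u) (_ : TopologicalSpace X), CompactSpace X ∧ T2Space X ∧
      ¬ MetrizableSpace X ∧ WeaklyInfiniteDimensional X ∧ ¬ PropertyC X := by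
  obtain ⟨X, _, _, _, hX, hC⟩ := h
  exact ⟨X ⊕ (ULift.{u} ℝ → Bool), inferInstance, inferInstance, inferInstance,
    fun _ => not_metrizableSpace_cube (Topology.IsEmbedding.inr (X := X)).metrizableSpace,
    hX.sum weaklyInfiniteDimensional_of_totallyDisconnected, fun h => hC h.of_sum⟩

/-! ### Countable elementary sublattices and property C -/

section PropertyC

open WallmanSpace

variable {X : Type u} [TopologicalSpace X]

theorem metrizableSpace_wallmanSpace [CompactSpace X] [T2Space X]
    (L : latticeLanguage.ElementarySubstructure (Closeds X)) [Countable L] :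
    MetrizableSpace (WallmanSpace L) := by
  have := t2Space (ElementarySublattice.isNormalLattice (isClosedBase_closeds X).isNormalLattice L)
  have : SecondCountableTopology (WallmanSpace L) := by
    refine (isTopologicalBasis (L := L)).secondCountableTopology ?_
    refine (Set.countable_range fun a : L => (hat a)ᶜ).mono ?_
    rintro _ ⟨a, rfl⟩
    exact ⟨a, rfl⟩
  infer_instance

/-- The open set of `X` that corresponds to the open set `V` of the Wallman space: the union of the
complements of those `a ∈ L` for which the basic open set given by `a` lies in `V`. -/
def wallmanTrace (L : latticeLanguage.ElementarySubstructure (Closeds X))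
    (V : Set (WallmanSpace L)) : Set X :=
  ⋃ a ∈ {a : L | (hat a)ᶜ ⊆ V}, ((a : Closeds X) : Set X)ᶜ

theorem mem_wallmanTrace {L : latticeLanguage.ElementarySubstructure (Closeds X)}
    {V : Set (WallmanSpace L)} {x : X} :
    x ∈ wallmanTrace L V ↔ ∃ a : L, (hat a)ᶜ ⊆ V ∧ x ∉ (a : Closeds X) := by
  simp [wallmanTrace]

theorem isOpen_wallmanTrace (L : latticeLanguage.ElementarySubstructure (Closeds X))
    (V : Set (WallmanSpace L)) : IsOpen (wallmanTrace L V) :=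
  isOpen_biUnion fun a _ => a.1.isClosed.isOpen_compl

theorem disjoint_wallmanTrace [T1Space X] {L : latticeLanguage.ElementarySubstructure (Closeds X)}
    {V W : Set (WallmanSpace L)} (h : Disjoint V W) :
    Disjoint (wallmanTrace L V) (wallmanTrace L W) := by
  have hs := ElementarySublattice.isSeparativeLattice (isClosedBase_closeds X).isSeparativeLattice L
  rw [Set.disjoint_left]
  intro x hx hx'
  obtain ⟨a, ha, hxa⟩ := mem_wallmanTrace.1 hx
  obtain ⟨b, hb, hxb⟩ := mem_wallmanTrace.1 hx'
  have hab : hat (⊤ : L) ⊆ hat (a ⊔ b) := by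
    intro u _
    rw [hat_sup]
    by_contra hu
    exact h.le_bot ⟨ha fun h => hu (Or.inl h), hb fun h => hu (Or.inr h)⟩
  have hx : x ∈ ((a ⊔ b : L) : Closeds X) :=
    le_of_hat_subset hs hab (show x ∈ (⊤ : Closeds X) from trivial)
  exact hx.elim hxa hxb

theorem wallmanTrace_subset [T1Space X] {L : latticeLanguage.ElementarySubstructure (Closeds X)}
    {V : Set (WallmanSpace L)} {a : L} (h : V ⊆ (hat a)ᶜ) :
    wallmanTrace L V ⊆ ((a : Closeds X) : Set X)ᶜ := by
  have hs := ElementarySublattice.isSeparativeLattice (isClosedBase_closeds X).isSeparativeLattice L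
  intro x hx hxa
  obtain ⟨b, hb, hxb⟩ := mem_wallmanTrace.1 hx
  exact hxb (le_of_hat_subset hs (Set.compl_subset_compl.1 (hb.trans h)) hxa)

/-- Traces of open covers are covers: a point of `X` outside of all the traces would make every
ultrafilter extending `{a ∈ L | x ∈ a}` miss the cover. -/
theorem exists_mem_wallmanTrace {L : latticeLanguage.ElementarySubstructure (Closeds X)}
    {𝒲 : Set (Set (WallmanSpace L))} (hopen : ∀ V ∈ 𝒲, IsOpen V) (hcov : ⋃₀ 𝒲 = Set.univ) (x : X) :
    ∃ V ∈ 𝒲, x ∈ wallmanTrace L V := by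
  by_contra! hcon
  obtain ⟨u, hu⟩ := exists_forall_mem {a : L | x ∈ (a : Closeds X)}
    (fun a ha b hb => show x ∈ ((a : Closeds X) ⊓ b) from ⟨ha, hb⟩)
    (fun h => (show x ∉ (⊥ : Closeds X) from Set.notMem_empty x) h)
    ⟨⊤, show x ∈ (⊤ : Closeds X) from trivial⟩
  obtain ⟨V, hV, huV⟩ := Set.eq_univ_iff_forall.1 hcov u
  obtain ⟨_, ⟨a, rfl⟩, hua, haV⟩ := isTopologicalBasis.exists_subset_of_mem_open huV (hopen V hV)
  exact hcon V hV (mem_wallmanTrace.2 ⟨a, haV, fun hx => hua (hu a hx)⟩)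

/-- If a Wallman space of `L` has property C and `L` contains the complements of the members of
finite subcovers of the given covers, then the traces of disjoint refinements in the Wallman space
are disjoint refinements in `X`. -/
theorem exists_disjoint_refinement_of_propertyC_wallmanSpace [T1Space X]
    {L : latticeLanguage.ElementarySubstructure (Closeds X)} (hC : PropertyC (WallmanSpace L))
    (t : ℕ → Finset L) (ht : ∀ i x, ∃ a ∈ t i, x ∉ (a : Closeds X)) :
    ∃ 𝒱 : ℕ → Set (Set X), (∀ i, ∀ V ∈ 𝒱 i, IsOpen V) ∧ (∀ i, (𝒱 i).Pairwise Disjoint) ∧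
      (∀ i, ∀ V ∈ 𝒱 i, ∃ a ∈ t i, V ⊆ ((a : Closeds X) : Set X)ᶜ) ∧
      ⋃ i, ⋃₀ 𝒱 i = Set.univ := by
  obtain ⟨𝒱, h1, h2, h3, h4⟩ := hC (fun i => (fun a => (hat a)ᶜ) '' (t i : Set L))
    (by
      rintro i _ ⟨a, -, rfl⟩
      exact (isClosed_hat a).isOpen_compl)
    (by
      refine fun i => Set.eq_univ_of_forall fun u => ?_
      by_contra! hu
      have hmem : ∀ a ∈ t i, a ∈ u.1 := fun a ha => by
        by_contra hau
        exact hu ⟨_, ⟨a, ha, rfl⟩, hau⟩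
      have hinf : (t i).inf id ∈ u.1 :=
        Finset.inf_induction (p := (· ∈ u.1)) Order.PFilter.top_mem
          (fun _ ha _ hb => Order.PFilter.inf_mem ha hb) hmem
      have hbot : (t i).inf id = ⊥ := by
        refine Subtype.ext (SetLike.coe_injective (Set.eq_empty_iff_forall_notMem.2 fun x hx => ?_))
        obtain ⟨a, ha, hxa⟩ := ht i x
        have hle : (t i).inf id ≤ a := Finset.inf_le (f := id) ha
        exact hxa (hle hx)
      exact bot_notMem u (hbot ▸ hinf))
  refine ⟨fun i => wallmanTrace L '' 𝒱 i, ?_, ?_, ?_, Set.eq_univ_of_forall fun x => ?_⟩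
  · rintro i _ ⟨V, -, rfl⟩
    exact isOpen_wallmanTrace L V
  · rintro i _ ⟨V, hV, rfl⟩ _ ⟨W, hW, rfl⟩ hne
    exact disjoint_wallmanTrace (h2 i hV hW fun h => hne (by rw [h]))
  · rintro i _ ⟨V, hV, rfl⟩
    obtain ⟨_, ⟨a, ha, rfl⟩, hVa⟩ := h3 i V hV
    exact ⟨a, ha, wallmanTrace_subset hVa⟩
  · obtain ⟨V, hV, hx⟩ := exists_mem_wallmanTrace (𝒲 := ⋃ i, 𝒱 i)
      (fun V hV => by
        obtain ⟨i, hV⟩ := Set.mem_iUnion.1 hV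
        exact h1 i V hV)
      (by rw [Set.sUnion_iUnion, h4]) x
    obtain ⟨i, hV⟩ := Set.mem_iUnion.1 hV
    exact Set.mem_iUnion.2 ⟨i, _, ⟨V, hV, rfl⟩, hx⟩

theorem card_latticeLanguage_le : latticeLanguage.card ≤ Cardinal.aleph0 := by
  have h : ∀ n, Countable (latticeLanguage.Functions n) := fun n => by
    let f : LatticeFunc n → ℕ := fun g => match g with
      | .bot => 0
      | .top => 1
      | .sup => 2
      | .inf => 3
    have hf : Function.Injective f := by
      intro g g' hg
      cases g <;> cases g' <;> first | rfl | cases hg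
    exact hf.countable
  have h' : ∀ n, Countable (latticeLanguage.Relations n) := fun n =>
    inferInstanceAs (Countable Empty)
  rw [FirstOrder.Language.card, Cardinal.mk_le_aleph0_iff]
  exact inferInstanceAs (Countable (_ ⊕ _))

theorem exists_metrizable_of_nonmetrizable
    (h : ∃ (X : Type u) (_ : TopologicalSpace X), CompactSpace X ∧ T2Space X ∧
      ¬ MetrizableSpace X ∧ WeaklyInfiniteDimensional X ∧ ¬ PropertyC X) :
    ∃ (X : Type u) (_ : TopologicalSpace X), CompactSpace X ∧ MetrizableSpace X ∧
      WeaklyInfiniteDimensional X ∧ ¬ PropertyC X := by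
  classical
  obtain ⟨X, _, _, _, hm, hX, hC⟩ := h
  -- A finite Hausdorff space is discrete; the Löwenheim–Skolem theorem needs `2^X` to be infinite.
  have hinf : Infinite X := by
    by_contra hfin
    have : Finite X := not_infinite_iff_finite.1 hfin
    exact hm inferInstance
  rw [PropertyC] at hC
  push Not at hC
  obtain ⟨𝒰, hopen, hcov, hC⟩ := hC
  have hfin : ∀ i, ∃ t : Finset (Closeds X), (∀ a ∈ t, (a : Set X)ᶜ ∈ 𝒰 i) ∧
      ∀ x, ∃ a ∈ t, x ∉ a := fun i => by
    obtain ⟨t, ht⟩ := isCompact_univ.elim_finite_subcover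
      (fun a : {a : Closeds X // (a : Set X)ᶜ ∈ 𝒰 i} => ((a : Closeds X) : Set X)ᶜ)
      (fun a => a.1.isClosed.isOpen_compl) (fun x _ => by
        obtain ⟨U, hU, hx⟩ := Set.eq_univ_iff_forall.1 (hcov i) x
        exact Set.mem_iUnion.2 ⟨⟨⟨Uᶜ, (hopen i U hU).isClosed_compl⟩, by simpa using hU⟩,
          by simpa using hx⟩)
    refine ⟨t.map (Function.Embedding.subtype _), fun a ha => ?_, fun x => ?_⟩
    · obtain ⟨a, -, rfl⟩ := Finset.mem_map.1 ha
      exact a.2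
    · obtain ⟨a, ha, hx⟩ := Set.mem_iUnion₂.1 (ht (Set.mem_univ x))
      exact ⟨a, Finset.mem_map_of_mem _ ha, hx⟩
  choose t ht htx using hfin
  obtain ⟨L, hL, hcard⟩ := latticeLanguage.exists_elementarySubstructure_card_eq
    (⋃ i, (t i : Set (Closeds X))) Cardinal.aleph0.{0} le_rfl
    (by simpa using (Set.countable_iUnion fun i => (t i).countable_toSet).le_aleph0)
    (by simpa using card_latticeLanguage_le)
    (by
      have : Infinite (Closeds X) := Infinite.of_injective
        (fun x : X => (⟨{x}, isClosed_singleton⟩ : Closeds X))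
        fun x y h => Set.singleton_injective (congrArg (fun C : Closeds X => (C : Set X)) h)
      simp)
  have : Countable L := by
    rw [← Cardinal.mk_le_aleph0_iff]
    simpa using hcard.le
  have := metrizableSpace_wallmanSpace L
  refine ⟨WallmanSpace L, inferInstance, inferInstance, inferInstance,
    elementarilyReflected_weaklyInfiniteDimensional X hX L, fun hCL => ?_⟩
  obtain ⟨𝒱, h1, h2, h3, h4⟩ := exists_disjoint_refinement_of_propertyC_wallmanSpace hCL
    (fun i => (t i).subtype (· ∈ L)) fun i x => by
      obtain ⟨a, ha, hx⟩ := htx i x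
      exact ⟨⟨a, hL (Set.mem_iUnion.2 ⟨i, ha⟩)⟩, Finset.mem_subtype.2 ha, hx⟩
  refine hC 𝒱 h1 h2 (fun i V hV => ?_) h4
  obtain ⟨a, ha, hVa⟩ := h3 i V hV
  exact ⟨_, ht i a (Finset.mem_subtype.1 ha), hVa⟩

end PropertyC

theorem mainTheorem5 :
    ElementarilyReflectedBySubmodels.{u} (fun Y _ => StronglyInfiniteDimensional Y) ∧
    ElementarilyReflectedBySubmodels.{u} (fun Y _ => WeaklyInfiniteDimensional Y) ∧
    ElementarilyReflected.{u} (fun Y _ => WeaklyInfiniteDimensional Y) ∧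
    ((∃ (X : Type u) (_ : TopologicalSpace X), CompactSpace X ∧ MetrizableSpace X ∧
        WeaklyInfiniteDimensional X ∧ ¬ PropertyC X) ↔
      (∃ (X : Type u) (_ : TopologicalSpace X), CompactSpace X ∧ T2Space X ∧
        ¬ MetrizableSpace X ∧ WeaklyInfiniteDimensional X ∧ ¬ PropertyC X)) :=
  ⟨elementarilyReflectedBySubmodels_stronglyInfiniteDimensional,
    elementarilyReflectedBySubmodels_weaklyInfiniteDimensional,
    elementarilyReflected_weaklyInfiniteDimensional,
    exists_nonmetrizable_of_metrizable, exists_metrizable_of_nonmetrizable⟩
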